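/- Let $d\ge 1$, let $\mathbb R^{d^2}$ be identified with the real $d\times d$ arrays $X$, and let $\Omega\in\mathbb R^{2d(d-1)\times d^2}$ be the two-dimensional difference operator, whose action on $X$ collects all vertical differences $X_{i+1,j}-X_{i,j}$ ($1\le i\le d-1$, $1\le j\le d$) and all horizontal differences $X_{i,j+1}-X_{i,j}$ ($1\le i\le d$, $1\le j\le d-1$). Let $x\in\mathbb R^{d^2}$ be $\ell$-cosparse with respect to $\Omega$, that is, exactly $\ell$ of the entries of $\Omega x$ are zero, and put $s=2d(d-1)-\ell$, the number of non-zero entries of $\Omega x$. Let $M\in\mathbb R^{m\times d^2}$ be a Gaussian random matrix, i.e. its entries are independent standard normal random variables, and let $\eta\in\mathbb R$, $\tau>0$ and $0<\varepsilon<1$. Suppose that $$\frac{m^2}{m+1}\ \ge\ \left(\sqrt{d^2\left(1-\frac1\pi\left(1-\frac1d-\frac{s}{2d^2}\right)^2\right)}+\sqrt{2\ln(\varepsilon^{-1})}+\tau\right)^2 .$$ Then with probability at least $1-\varepsilon$ on the draw of $M$ the following holds: for every $w\in\mathbb R^m$ with $\|w\|_2\le\eta$ and $y=Mx+w$, any minimizer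 $\hat x$ of $$\min_{z\in\mathbb R^{d^2}}\|\Omega z\|_1\quad\text{subject to}\quad\|Mz-y\|_2\le\eta$$ satisfies $$\|x-\hat x\|_2\le\frac{2\eta}{\tau}.$$ -/

import Mathlib

open MeasureTheory ProbabilityTheory
open scoped Matrix

noncomputable section

namespace AnalysisRecovery

/-- The seminorm `z ↦ ‖Ω z‖₁` generated by an analysis operator `Ω`. -/
def analysisL1 {ι κ : Type*} [Fintype ι] [Fintype κ] (Ω : Matrix ι κ ℝ)
    (z : EuclideanSpace ℝ κ) : ℝ :=
  ∑ i, |(Ω *ᵥ z.ofLp) i|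

/-- The number of non-zero entries of `Ω x`. -/
def analysisSparsity {ι κ : Type*} [Fintype ι] [Fintype κ] (Ω : Matrix ι κ ℝ)
    (x : EuclideanSpace ℝ κ) : ℕ :=
  (Finset.univ.filter fun i => (Ω *ᵥ x.ofLp) i ≠ 0).card

/-- `x` is `ℓ`-cosparse with respect to `Ω ∈ ℝ^{p × d}`: `ℓ = p - s`, where `s` is the number of
non-zero entries of `Ω x`. -/
def IsCosparse {ι κ : Type*} [Fintype ι] [Fintype κ] (Ω : Matrix ι κ ℝ) (ℓ : ℕ)
    (x : EuclideanSpace ℝ κ) : Prop :=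
  analysisSparsity Ω x + ℓ = Fintype.card ι

/-- The vector `M z` as an element of Euclidean space. -/
def applyMat {μ κ : Type*} [Fintype κ] (M : Matrix μ κ ℝ) (z : EuclideanSpace ℝ κ) :
    EuclideanSpace ℝ μ :=
  WithLp.toLp 2 (M *ᵥ z.ofLp)

/-- `xhat` is a minimizer of `‖Ω z‖₁` subject to `‖M z - y‖₂ ≤ η`. -/
def IsMinimizer {ι μ κ : Type*} [Fintype ι] [Fintype μ] [Fintype κ] (Ω : Matrix ι κ ℝ)
    (M : Matrix μ κ ℝ) (y : EuclideanSpace ℝ μ) (η : ℝ) (xhat : EuclideanSpace ℝ κ) : Prop :=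
  ‖applyMat M xhat - y‖ ≤ η ∧
    ∀ z : EuclideanSpace ℝ κ, ‖applyMat M z - y‖ ≤ η → analysisL1 Ω xhat ≤ analysisL1 Ω z

/-- A Gaussian random matrix: its entries are independent standard normal random variables. -/
structure IsGaussianMatrix {S : Type*} [MeasurableSpace S] (P : Measure S) {μ κ : Type*}
    (M : S → Matrix μ κ ℝ) : Prop where
  hasLaw : ∀ i j, HasLaw (fun ω => M ω i j) (gaussianReal 0 1) P
  indep : iIndepFun (fun (ij : μ × κ) (ω : S) => M ω ij.1 ij.2) P

/-- Row indices of the two-dimensional difference operator on `d × d` arrays: the vertical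
differences followed by the horizontal ones. -/
abbrev DiffIndex (d : ℕ) : Type := (Fin (d - 1) × Fin d) ⊕ (Fin d × Fin (d - 1))

theorem card_diffIndex (d : ℕ) : Fintype.card (DiffIndex d) = 2 * d * (d - 1) := by
  simp only [Fintype.card_sum, Fintype.card_prod, Fintype.card_fin]
  ring

/-- The index `i` in `{0, …, d - 1}`, for `i` in `{0, …, d - 2}`. -/
def lo {d : ℕ} (i : Fin (d - 1)) : Fin d := ⟨i.1, by omega⟩

/-- The index `i + 1` in `{0, …, d - 1}`, for `i` in `{0, …, d - 2}`. -/
def hi {d : ℕ} (i : Fin (d - 1)) : Fin d := ⟨i.1 + 1, by omega⟩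

/-- The two-dimensional difference operator. A vector `x ∈ ℝ^{d²}`, indexed by pairs `(i, j)`, is
the array `X` with entries `X i j = x (i, j)`. -/
def diffOp (d : ℕ) : Matrix (DiffIndex d) (Fin d × Fin d) ℝ :=
  Matrix.of fun r => match r with
    | Sum.inl (i, j) => Pi.single (hi i, j) 1 - Pi.single (lo i, j) 1
    | Sum.inr (i, j) => Pi.single (i, hi j) 1 - Pi.single (i, lo j) 1

theorem diffOp_mulVec_inl {d : ℕ} (x : Fin d × Fin d → ℝ) (i : Fin (d - 1)) (j : Fin d) :
    (diffOp d *ᵥ x) (Sum.inl (i, j)) = x (hi i, j) - x (lo i, j) := by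
  change ((Pi.single (hi i, j) 1 - Pi.single (lo i, j) 1 : Fin d × Fin d → ℝ) ⬝ᵥ x) = _
  rw [sub_dotProduct, single_one_dotProduct, single_one_dotProduct]

theorem diffOp_mulVec_inr {d : ℕ} (x : Fin d × Fin d → ℝ) (i : Fin d) (j : Fin (d - 1)) :
    (diffOp d *ᵥ x) (Sum.inr (i, j)) = x (i, hi j) - x (i, lo j) := by
  change ((Pi.single (i, hi j) 1 - Pi.single (i, lo j) 1 : Fin d × Fin d → ℝ) ⬝ᵥ x) = _
  rw [sub_dotProduct, single_one_dotProduct, single_one_dotProduct]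

end AnalysisRecovery

end

/-! The error `xhat - x` of a minimizer is a descent direction of `‖Ω ·‖₁` at `x`, and feasibility
of both points gives `‖M (xhat - x)‖ ≤ 2η`. So it suffices that `‖M z‖ ≥ τ` for all unit `z` with
`dirDeriv Ω x z ≤ 0` (`IsMinimizer.norm_sub_le`). This is Gordon's escape through a mesh
(`exists_measurableSet_le_norm`): it holds outside an event of probability `exp (-r²/2)` as soon as
width + `r` + `τ` is at most `m / √(m+1)`. The choice `r = √(2 ln ε⁻¹)` makes the exceptional
probability `ε`.

The Gaussian tools all rest on one interpolation formula. Along `cos θ • A g + sin θ • B g`, with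
`A` and `B` reading disjoint coordinates, integration by parts expresses the derivative of `E F`
through the difference of the second derivatives of `F` along the images of the basis vectors under
`B` and `A`. This yields rotation invariance, concentration (through a differential inequality for
the moment generating function) and Gordon's comparison of `‖M z_i‖` with `‖h‖ - ⟨g, z_i⟩`. In the
comparison, minima are replaced by log-sum-exp and norms by `√(‖a‖² + δ²)`. The deterministic heart
is `weightedVar_gordon`, that is `(1 - ⟨z_i, z_k⟩)(1 - ⟨n_i, n_k⟩) ≥ 0`. The constant `m / √(m+1)`
is a lower bound for `E ‖h‖`, obtained by Stein's identity in `le_integral_smoothNorm`. Finite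
families are extended to arbitrary sets of unit vectors through a countable dense subset.

The width is bounded by duality (`exists_width_bound`). For a subgradient `b` at `x` and `t ≥ 0`, a
unit descent direction satisfies `⟨g, z⟩ ≤ ⟨g - t b, z⟩ ≤ ‖g - t b‖`. With `b` chosen to maximize
`⟨b, g⟩`, the expectation of `‖g - t b‖²` is at most `d² - 2tℓ · 2/√π + 16 d² t²`: each vanishing
difference contributes `E |g_a - g_b| = 2/√π`, and every column of `Ω` has absolute sum at most 4.
Optimizing `t` gives the square root in the hypothesis. -/

noncomputable section

namespace AnalysisRecovery

/-! ### Functions of at most exponential growth -/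

section Growth

variable {E F G : Type*} [NormedAddCommGroup E] [NormedAddCommGroup F] [NormedAddCommGroup G]

/-- At most exponential growth. -/
def ExpGrowth (u : E → F) : Prop :=
  ∃ C : ℝ, 0 ≤ C ∧ ∀ x, ‖u x‖ ≤ C * Real.exp (C * ‖x‖)

theorem exp_mul_norm_mono {C D r : ℝ} (h : C ≤ D) (hr : 0 ≤ r) :
    Real.exp (C * r) ≤ Real.exp (D * r) :=
  Real.exp_le_exp.2 (mul_le_mul_of_nonneg_right h hr)

theorem ExpGrowth.of_bound {u : E → F} (C c : ℝ) (h : ∀ x, ‖u x‖ ≤ C * Real.exp (c * ‖x‖)) :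
    ExpGrowth u := by
  refine ⟨max (max C c) 0, le_max_right _ _, fun x => (h x).trans ?_⟩
  have h1 : C ≤ max (max C c) 0 := (le_max_left _ _).trans (le_max_left _ _)
  have h2 : c ≤ max (max C c) 0 := (le_max_right _ _).trans (le_max_left _ _)
  exact mul_le_mul h1 (exp_mul_norm_mono h2 (norm_nonneg x)) (Real.exp_pos _).le (le_max_right _ _)

theorem ExpGrowth.of_le_const {u : E → F} (C : ℝ) (h : ∀ x, ‖u x‖ ≤ C) : ExpGrowth u :=
  .of_bound C 0 fun x => by simpa using h x

theorem ExpGrowth.mono {u : E → F} {v : E → G} (hv : ExpGrowth v) (h : ∀ x, ‖u x‖ ≤ ‖v x‖) :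
    ExpGrowth u := by
  obtain ⟨C, hC, hb⟩ := hv
  exact ⟨C, hC, fun x => (h x).trans (hb x)⟩

theorem ExpGrowth.const (c : F) : ExpGrowth (fun _ : E => c) :=
  .of_le_const ‖c‖ fun _ => le_rfl

theorem ExpGrowth.norm {u : E → F} (hu : ExpGrowth u) : ExpGrowth fun x => ‖u x‖ :=
  hu.mono fun x => by simp

theorem ExpGrowth.neg {u : E → F} (hu : ExpGrowth u) : ExpGrowth fun x => -u x :=
  hu.mono fun x => by simp

theorem ExpGrowth.add {u v : E → F} (hu : ExpGrowth u) (hv : ExpGrowth v) :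
    ExpGrowth fun x => u x + v x := by
  obtain ⟨C, hC, hb⟩ := hu
  obtain ⟨D, hD, hb'⟩ := hv
  refine .of_bound (C + D) (max C D) fun x => ?_
  have h1 := exp_mul_norm_mono (le_max_left C D) (norm_nonneg x)
  have h2 := exp_mul_norm_mono (le_max_right C D) (norm_nonneg x)
  calc ‖u x + v x‖ ≤ C * Real.exp (C * ‖x‖) + D * Real.exp (D * ‖x‖) :=
        (norm_add_le _ _).trans (add_le_add (hb x) (hb' x))
    _ ≤ C * Real.exp (max C D * ‖x‖) + D * Real.exp (max C D * ‖x‖) := by gcongr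
    _ = _ := by ring

theorem ExpGrowth.sub {u v : E → F} (hu : ExpGrowth u) (hv : ExpGrowth v) :
    ExpGrowth fun x => u x - v x := by
  simpa only [sub_eq_add_neg] using hu.add hv.neg

theorem ExpGrowth.mul {u v : E → ℝ} (hu : ExpGrowth u) (hv : ExpGrowth v) :
    ExpGrowth fun x => u x * v x := by
  obtain ⟨C, hC, hb⟩ := hu
  obtain ⟨D, hD, hb'⟩ := hv
  refine .of_bound (C * D) (C + D) fun x => ?_
  calc ‖u x * v x‖ ≤ (C * Real.exp (C * ‖x‖)) * (D * Real.exp (D * ‖x‖)) := by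
        rw [norm_mul]
        exact mul_le_mul (hb x) (hb' x) (norm_nonneg _) (by positivity)
    _ = _ := by rw [add_mul, Real.exp_add]; ring

theorem ExpGrowth.sum {ι : Type*} (s : Finset ι) {u : ι → E → F} (hu : ∀ i ∈ s, ExpGrowth (u i)) :
    ExpGrowth fun x => ∑ i ∈ s, u i x := by
  classical
  induction s using Finset.induction_on with
  | empty => simpa using ExpGrowth.const (0 : F)
  | insert a s ha ih =>
    simp only [Finset.sum_insert ha]
    exact (hu a (by simp)).add (ih fun i hi => hu i (by simp [hi]))

/-- The affine bound on `w` covers maps that are not linear, such as overwriting one coordinate of a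
fixed vector. -/
theorem ExpGrowth.comp_bound {u : E → F} {w : G → E} (hu : ExpGrowth u) (K : ℝ)
    (h : ∀ x, ‖w x‖ ≤ K * (1 + ‖x‖)) : ExpGrowth fun x => u (w x) := by
  obtain ⟨C, hC, hb⟩ := hu
  refine .of_bound (C * Real.exp (C * K)) (C * K) fun x => (hb _).trans ?_
  rw [mul_assoc, ← Real.exp_add]
  refine mul_le_mul_of_nonneg_left (Real.exp_le_exp.2 ?_) hC
  nlinarith [mul_le_mul_of_nonneg_left (h x) hC]

theorem ExpGrowth.of_linear {u : E → F} (K : ℝ) (h : ∀ x, ‖u x‖ ≤ K * (1 + ‖x‖)) :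
    ExpGrowth u := by
  refine .of_bound |K| 1 fun x => (h x).trans ?_
  have h1 := Real.add_one_le_exp ‖x‖
  calc K * (1 + ‖x‖) ≤ |K| * (1 + ‖x‖) := by gcongr; exact le_abs_self K
    _ ≤ |K| * Real.exp (1 * ‖x‖) := by gcongr; rw [one_mul]; linarith

theorem ExpGrowth.exp_of_linear {u : E → ℝ} (K : ℝ) (h : ∀ x, u x ≤ K * (1 + ‖x‖)) :
    ExpGrowth fun x => Real.exp (u x) := by
  refine .of_bound (Real.exp K) K fun x => ?_
  rw [Real.norm_eq_abs, Real.abs_exp, ← Real.exp_add]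
  exact Real.exp_le_exp.2 ((h x).trans (by linarith))

theorem ExpGrowth.clm [NormedSpace ℝ E] [NormedSpace ℝ F] (L : E →L[ℝ] F) :
    ExpGrowth fun x => L x :=
  .of_linear ‖L‖ fun x => (L.le_opNorm x).trans
    (mul_le_mul_of_nonneg_left (by linarith) (norm_nonneg _))

theorem ExpGrowth.comp_clm [NormedSpace ℝ E] [NormedSpace ℝ G] {u : E → F} (hu : ExpGrowth u)
    (L : G →L[ℝ] E) : ExpGrowth fun x => u (L x) :=
  hu.comp_bound ‖L‖ fun x => (L.le_opNorm x).trans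
    (mul_le_mul_of_nonneg_left (by linarith) (norm_nonneg _))

end Growth

/-! ### The standard Gaussian measure and integration by parts -/

/-- The law of a family of independent standard normal random variables. -/
def stdGaussianPi (κ : Type*) [Fintype κ] : Measure (κ → ℝ) :=
  Measure.pi fun _ => gaussianReal 0 1

instance (κ : Type*) [Fintype κ] : IsProbabilityMeasure (stdGaussianPi κ) := by
  unfold stdGaussianPi; infer_instance

theorem integrable_exp_mul_abs_gaussianReal (C : ℝ) :
    Integrable (fun t => Real.exp (C * |t|)) (gaussianReal 0 1) := by
  refine ((integrable_exp_mul_gaussianReal (μ := 0) (v := 1) C).add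
    (integrable_exp_mul_gaussianReal (-C))).mono' (by fun_prop) (.of_forall fun t => ?_)
  rw [Real.norm_eq_abs, Real.abs_exp]
  have h1 := Real.exp_pos (C * t)
  have h2 := Real.exp_pos (-C * t)
  simp only [Pi.add_apply]
  rcases abs_cases t with ⟨h, -⟩ | ⟨h, -⟩ <;> rw [h]
  · linarith
  · rw [mul_neg, ← neg_mul]; linarith

theorem ExpGrowth.integrable_gaussianReal {u : ℝ → ℝ} (hu : ExpGrowth u)
    (hm : AEStronglyMeasurable u (gaussianReal 0 1)) : Integrable u (gaussianReal 0 1) := by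
  obtain ⟨C, -, h⟩ := hu
  exact ((integrable_exp_mul_abs_gaussianReal C).const_mul C).mono' hm (.of_forall h)

theorem ExpGrowth.integrable {κ : Type*} [Fintype κ] {u : (κ → ℝ) → ℝ} (hu : ExpGrowth u)
    (hm : AEStronglyMeasurable u (stdGaussianPi κ)) : Integrable u (stdGaussianPi κ) := by
  obtain ⟨C, hC, h⟩ := hu
  have h1 : Integrable (fun x : κ → ℝ => ∏ i, Real.exp (C * |x i|)) (stdGaussianPi κ) :=
    Integrable.fintype_prod (f := fun (_ : κ) (t : ℝ) => Real.exp (C * |t|))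
      fun _ => integrable_exp_mul_abs_gaussianReal C
  refine (h1.const_mul C).mono' hm (.of_forall fun x => (h x).trans ?_)
  refine mul_le_mul_of_nonneg_left ?_ hC
  rw [← Real.exp_sum, ← Finset.mul_sum]
  refine Real.exp_le_exp.2 (mul_le_mul_of_nonneg_left ?_ hC)
  refine (pi_norm_le_iff_of_nonneg (Finset.sum_nonneg fun i _ => abs_nonneg _)).2 fun i => ?_
  exact Finset.single_le_sum (f := fun i => |x i|) (fun i _ => abs_nonneg _) (Finset.mem_univ i)

/-- The Gaussian density satisfies `p' = -t p`, so this is integration by parts on the line;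
exponential growth supplies the integrability that removes the boundary terms. -/
theorem integral_id_mul_gaussianReal {u u' : ℝ → ℝ} (hu : ∀ t, HasDerivAt u (u' t) t)
    (hg : ExpGrowth u) (hg' : ExpGrowth u') :
    ∫ t, t * u t ∂gaussianReal 0 1 = ∫ t, u' t ∂gaussianReal 0 1 := by
  set p := gaussianPDFReal 0 1 with hp
  have hpd : ∀ t, HasDerivAt p (-t * p t) t := by
    intro t
    have h0 : p = fun t : ℝ => (√(2 * Real.pi))⁻¹ * Real.exp (-t ^ 2 / 2) := by
      ext t; simp [hp, gaussianPDFReal]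
    rw [h0]
    have h1 : HasDerivAt (fun t : ℝ => -t ^ 2 / 2) (-t) t :=
      ((hasDerivAt_pow 2 t).neg.div_const 2).congr_deriv (by simp; ring)
    exact (h1.exp.const_mul _).congr_deriv (by ring)
  have key : ∀ {v : ℝ → ℝ}, ExpGrowth v → Measurable v → Integrable (fun t => p t * v t) := by
    intro v hv hvm
    have := hv.integrable_gaussianReal hvm.aestronglyMeasurable
    rw [gaussianReal_of_var_ne_zero _ one_ne_zero] at this
    rw [integrable_withDensity_iff_integrable_smul' (by fun_prop) (.of_forall fun _ => gaussianPDF_lt_top)] at this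
    simpa [toReal_gaussianPDF] using this
  have hum : Measurable u := (continuous_iff_continuousAt.2 fun t => (hu t).continuousAt).measurable
  have hum' : Measurable u' := by
    have : u' = deriv u := by ext t; exact (hu t).deriv.symm
    rw [this]; exact measurable_deriv u
  have hid : ExpGrowth (fun t : ℝ => t) := .of_linear 1 fun x => by linarith
  have := integral_mul_deriv_eq_deriv_mul_of_integrable (u := u) (v := p) (u' := u')
    (v' := fun t => -t * p t) (fun t _ => hu t) (fun t _ => hpd t)
    ((key (hid.mul hg).neg (by fun_prop)).congr (.of_forall fun t => by simp; ring))
    ((key hg' hum').congr (.of_forall fun t => by simp; ring))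
    ((key hg hum).congr (.of_forall fun t => by simp; ring))
  rw [integral_gaussianReal_eq_integral_smul one_ne_zero,
    integral_gaussianReal_eq_integral_smul one_ne_zero]
  simp only [smul_eq_mul]
  calc _ = - ∫ t, u t * (-t * p t) := by
        rw [← integral_neg]; congr 1; ext t; ring
    _ = ∫ t, u' t * p t := by rw [this, neg_neg]
    _ = _ := by congr 1; ext t; ring

section Pi
variable {κ : Type*} [Fintype κ] [DecidableEq κ]

/-- Resampling one coordinate independently does not change the law. This is the Fubini step that
reduces integration by parts in `κ → ℝ` to the one-dimensional case. -/
theorem measurePreserving_update (k : κ) :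
    MeasurePreserving (fun z : (κ → ℝ) × ℝ => Function.update z.1 k z.2)
      ((stdGaussianPi κ).prod (gaussianReal 0 1)) (stdGaussianPi κ) := by
  have hmeas : Measurable fun z : (κ → ℝ) × ℝ => Function.update z.1 k z.2 := by
    refine measurable_pi_iff.2 fun j => ?_
    by_cases h : j = k
    · subst h; simpa using measurable_snd
    · simp only [Function.update_of_ne h]; fun_prop
  refine ⟨hmeas, ?_⟩
  refine (Measure.pi_eq fun s hs => ?_).symm
  rw [Measure.map_apply hmeas (MeasurableSet.univ_pi hs)]
  have : (fun z : (κ → ℝ) × ℝ => Function.update z.1 k z.2) ⁻¹' (Set.univ.pi s) =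
      (Set.univ.pi (Function.update s k Set.univ)) ×ˢ s k := by
    ext ⟨x, t⟩
    simp only [Set.mem_preimage, Set.mem_univ_pi, Set.mem_prod]
    constructor
    · intro h
      refine ⟨fun j => ?_, by simpa using h k⟩
      by_cases hj : j = k
      · subst hj; simp
      · simpa [hj] using h j
    · rintro ⟨h, h'⟩ j
      by_cases hj : j = k
      · subst hj; simpa using h'
      · simpa [hj] using h j
  rw [this, Measure.prod_prod, stdGaussianPi, Measure.pi_pi,
    ← Finset.mul_prod_erase _ _ (Finset.mem_univ k),
    ← Finset.mul_prod_erase Finset.univ (fun i => gaussianReal 0 1 (s i)) (Finset.mem_univ k)]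
  rw [Function.update_self, measure_univ, one_mul, mul_comm]
  congr 1
  refine Finset.prod_congr rfl fun j hj => ?_
  rw [Function.update_of_ne (Finset.ne_of_mem_erase hj)]

/-- Gaussian integration by parts. -/
theorem integral_coord_mul_stdGaussianPi (k : κ) {u : (κ → ℝ) → ℝ}
    {u' : (κ → ℝ) → (κ → ℝ) →L[ℝ] ℝ} (hu : ∀ x, HasFDerivAt u (u' x) x)
    (hg : ExpGrowth u) (hg' : ExpGrowth fun x => u' x (Pi.single k 1)) :
    ∫ x, x k * u x ∂stdGaussianPi κ = ∫ x, u' x (Pi.single k 1) ∂stdGaussianPi κ := by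
  have hcont : Continuous u := continuous_iff_continuousAt.2 fun x => (hu x).continuousAt
  have hmu : Measurable u := hcont.measurable
  have hmu' : Measurable fun x => u' x (Pi.single k 1) := by
    have : (fun x => u' x (Pi.single k 1)) = fun x => fderiv ℝ u x (Pi.single k 1) := by
      ext x; rw [(hu x).fderiv]
    rw [this]; exact measurable_fderiv_apply_const ℝ u _
  have hcoord : ExpGrowth fun x : κ → ℝ => x k :=
    .clm (ContinuousLinearMap.proj (R := ℝ) (φ := fun _ : κ => ℝ) k)
  have hi1 : Integrable (fun x => x k * u x) (stdGaussianPi κ) :=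
    (hcoord.mul hg).integrable (by fun_prop)
  have hi2 : Integrable (fun x => u' x (Pi.single k 1)) (stdGaussianPi κ) :=
    hg'.integrable hmu'.aestronglyMeasurable
  have mp := measurePreserving_update k
  have hj1 := mp.integrable_comp_of_integrable hi1
  have hj2 := mp.integrable_comp_of_integrable hi2
  simp only [Function.comp_def] at hj1 hj2
  rw [← mp.map_eq, integral_map mp.measurable.aemeasurable (by rw [mp.map_eq]; exact hi1.1),
    integral_map mp.measurable.aemeasurable (by rw [mp.map_eq]; exact hi2.1),
    integral_prod _ hj1, integral_prod _ hj2]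
  refine integral_congr_ae (.of_forall fun x => ?_)
  simp only [Function.update_self]
  have hbd : ∀ t : ℝ, ‖Function.update x k t‖ ≤ (1 + ‖x‖) * (1 + ‖t‖) := by
    intro t
    refine (pi_norm_le_iff_of_nonneg (by positivity)).2 fun j => ?_
    by_cases hj : j = k
    · subst hj; rw [Function.update_self]; nlinarith [norm_nonneg x, norm_nonneg t]
    · rw [Function.update_of_ne hj]
      nlinarith [norm_nonneg x, norm_nonneg t, norm_le_pi_norm x j,
        mul_nonneg (norm_nonneg x) (norm_nonneg t)]
  refine integral_id_mul_gaussianReal (u := fun t => u (Function.update x k t)) (fun t => ?_)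
    (hg.comp_bound _ hbd) (hg'.comp_bound _ hbd)
  exact (hu _).comp_hasDerivAt t (hasDerivAt_update x k t)

end Pi

/-! ### Interpolation between two Gaussian families -/

section Interpolation

variable {E : Type*} [NormedAddCommGroup E] [NormedSpace ℝ E]

/-- `F` is twice differentiable, with first derivative `F'` and second derivatives
`F2 w x v = D(F' · w)(x) v`, all of them of at most exponential growth. -/
structure IsC2Exp (F : E → ℝ) (F' : E → E →L[ℝ] ℝ) (F2 : E → E → E →L[ℝ] ℝ) : Prop where
  deriv : ∀ x, HasFDerivAt F (F' x) x
  deriv2 : ∀ w x, HasFDerivAt (fun x => F' x w) (F2 w x) x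
  growth : ExpGrowth F
  growth1 : ∀ w, ExpGrowth fun x => F' x w
  growth2 : ∀ w v, ExpGrowth fun x => F2 w x v

variable {F : E → ℝ} {F' : E → E →L[ℝ] ℝ} {F2 : E → E → E →L[ℝ] ℝ}

theorem IsC2Exp.continuous (h : IsC2Exp F F' F2) : Continuous F :=
  continuous_iff_continuousAt.2 fun x => (h.deriv x).continuousAt

theorem IsC2Exp.continuous1 (h : IsC2Exp F F' F2) (w : E) : Continuous fun x => F' x w :=
  continuous_iff_continuousAt.2 fun x => (h.deriv2 w x).continuousAt

variable {κ : Type*}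

/-- The rotation path `cos θ A + sin θ B`. -/
def rotPath (A B : (κ → ℝ) →L[ℝ] E) (θ : ℝ) : (κ → ℝ) →L[ℝ] E :=
  Real.cos θ • A + Real.sin θ • B

theorem rotPath_apply (A B : (κ → ℝ) →L[ℝ] E) (θ : ℝ) (g : κ → ℝ) :
    rotPath A B θ g = Real.cos θ • A g + Real.sin θ • B g := rfl

variable [Fintype κ]

theorem IsC2Exp.integrable (h : IsC2Exp F F' F2) (L : (κ → ℝ) →L[ℝ] E) :
    Integrable (fun g => F (L g)) (stdGaussianPi κ) :=
  (h.growth.comp_clm L).integrable (h.continuous.comp L.continuous).aestronglyMeasurable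

theorem IsC2Exp.measurable2 [MeasurableSpace E] [BorelSpace E] (h : IsC2Exp F F' F2) (w v : E) :
    Measurable fun x => F2 w x v := by
  have : (fun x => F2 w x v) = fun x => fderiv ℝ (fun x => F' x w) x v := by
    ext x
    rw [(h.deriv2 w x).fderiv]
  rw [this]
  exact measurable_fderiv_apply_const ℝ _ v

theorem IsC2Exp.integrable2 [MeasurableSpace E] [BorelSpace E] (h : IsC2Exp F F' F2)
    (L : (κ → ℝ) →L[ℝ] E) (w v : E) :
    Integrable (fun g => F2 w (L g) v) (stdGaussianPi κ) :=
  ((h.growth2 w v).comp_clm L).integrable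
    ((h.measurable2 w v).comp L.continuous.measurable).aestronglyMeasurable

theorem norm_rotPath_le (A B : (κ → ℝ) →L[ℝ] E) (θ : ℝ) (g : κ → ℝ) :
    ‖rotPath A B θ g‖ ≤ (‖A‖ + ‖B‖) * ‖g‖ := by
  rw [rotPath_apply, add_mul]
  refine (norm_add_le _ _).trans (add_le_add ?_ ?_)
  · rw [norm_smul]
    exact (mul_le_of_le_one_left (norm_nonneg _) (Real.abs_cos_le_one θ)).trans (A.le_opNorm g)
  · rw [norm_smul]
    exact (mul_le_of_le_one_left (norm_nonneg _) (Real.abs_sin_le_one θ)).trans (B.le_opNorm g)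

variable [DecidableEq κ]

theorem IsC2Exp.integral_coord_mul (h : IsC2Exp F F' F2) (L : (κ → ℝ) →L[ℝ] E) (w : E) (k : κ) :
    ∫ g, g k * F' (L g) w ∂stdGaussianPi κ =
      ∫ g, F2 w (L g) (L (Pi.single k 1)) ∂stdGaussianPi κ :=
  integral_coord_mul_stdGaussianPi k (u := fun g => F' (L g) w)
    (u' := fun g => (F2 w (L g)).comp L)
    (fun g => (h.deriv2 w (L g)).comp g L.hasFDerivAt) ((h.growth1 w).comp_clm L)
    ((h.growth2 w _).comp_clm L)

theorem clm_pi_eq_sum {G : Type*} [NormedAddCommGroup G] [NormedSpace ℝ G] (L : (κ → ℝ) →L[ℝ] G)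
    (g : κ → ℝ) : L g = ∑ k, g k • L (Pi.single k 1) := by
  conv_lhs => rw [pi_eq_sum_univ' g]
  simp only [map_sum, map_smul]

/-- Differentiating under the integral produces terms `g k * F' w`, and integration by parts in `g
k` turns each into a second derivative. Since `A` and `B` never read the same coordinate, mixed
terms in `A` and `B` vanish and the factor `sin θ cos θ` comes out. -/
theorem hasDerivAt_integral_rotPath (h : IsC2Exp F F' F2) (A B : (κ → ℝ) →L[ℝ] E)
    (hAB : ∀ k, A (Pi.single k 1) = 0 ∨ B (Pi.single k 1) = 0) (θ : ℝ) :
    HasDerivAt (fun θ => ∫ g, F (rotPath A B θ g) ∂stdGaussianPi κ)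
      (Real.sin θ * Real.cos θ * ∑ k,
        ((∫ g, F2 (B (Pi.single k 1)) (rotPath A B θ g) (B (Pi.single k 1)) ∂stdGaussianPi κ)
        - ∫ g, F2 (A (Pi.single k 1)) (rotPath A B θ g) (A (Pi.single k 1)) ∂stdGaussianPi κ))
      θ := by
  set a : κ → E := fun k => A (Pi.single k 1) with ha
  set b : κ → E := fun k => B (Pi.single k 1) with hb
  set D : ℝ → (κ → ℝ) → ℝ := fun θ g =>
    F' (rotPath A B θ g) (-Real.sin θ • A g + Real.cos θ • B g) with hD
  have hDsum : ∀ θ g, D θ g = ∑ k, ((-Real.sin θ) * (g k * F' (rotPath A B θ g) (a k))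
      + Real.cos θ * (g k * F' (rotPath A B θ g) (b k))) := by
    intro θ g
    simp only [hD, map_add, map_smul]
    rw [clm_pi_eq_sum A g, clm_pi_eq_sum B g, map_sum, map_sum, Finset.sum_add_distrib]
    simp only [map_smul, smul_eq_mul, Finset.mul_sum]
    rfl
  have hcoord : ∀ k, ExpGrowth fun x : κ → ℝ => x k := fun k =>
    .clm (ContinuousLinearMap.proj (R := ℝ) (φ := fun _ : κ => ℝ) k)
  have hint1 : ∀ θ k w, Integrable (fun g => g k * F' (rotPath A B θ g) w) (stdGaussianPi κ) := by
    intro θ k w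
    refine ((hcoord k).mul ((h.growth1 w).comp_clm (rotPath A B θ))).integrable ?_
    exact ((continuous_apply k).mul
      ((h.continuous1 w).comp (rotPath A B θ).continuous)).aestronglyMeasurable
  have hDint : ∀ θ, Integrable (D θ) (stdGaussianPi κ) := by
    intro θ
    rw [funext (hDsum θ)]
    exact integrable_finsetSum _ fun k _ =>
      ((hint1 θ k (a k)).const_mul _).add ((hint1 θ k (b k)).const_mul _)
  choose C hC0 hC using fun w => h.growth1 w
  set K := ‖A‖ + ‖B‖
  -- A dominating function independent of `θ`: the norm of the path is at most `(‖A‖ + ‖B‖) ‖g‖` for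
  -- every angle.
  set bd : (κ → ℝ) → ℝ := fun g => ∑ k, (|g k| * (C (a k) * Real.exp (C (a k) * (K * ‖g‖)))
      + |g k| * (C (b k) * Real.exp (C (b k) * (K * ‖g‖)))) with hbd
  have hbdint : Integrable bd (stdGaussianPi κ) := by
    have : ExpGrowth bd := by
      refine .sum _ fun k _ => .add ?_ ?_
      · exact ((hcoord k).norm).mul ((ExpGrowth.const _).mul (.exp_of_linear (C (a k) * K) fun x => by
          have : 0 ≤ C (a k) * K := mul_nonneg (hC0 _) (by positivity)
          nlinarith))
      · exact ((hcoord k).norm).mul ((ExpGrowth.const _).mul (.exp_of_linear (C (b k) * K) fun x => by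
          have : 0 ≤ C (b k) * K := mul_nonneg (hC0 _) (by positivity)
          nlinarith))
    exact this.integrable (by rw [hbd]; fun_prop)
  have hbdle : ∀ θ g, ‖D θ g‖ ≤ bd g := by
    intro θ g
    rw [hDsum]
    refine (norm_sum_le _ _).trans (Finset.sum_le_sum fun k _ => (norm_add_le _ _).trans ?_)
    have hw : ∀ w, ‖F' (rotPath A B θ g) w‖ ≤ C w * Real.exp (C w * (K * ‖g‖)) := fun w =>
      (hC w _).trans (mul_le_mul_of_nonneg_left (Real.exp_le_exp.2
        (mul_le_mul_of_nonneg_left (norm_rotPath_le A B θ g) (hC0 w))) (hC0 w))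
    refine add_le_add ?_ ?_
    · rw [norm_mul, norm_mul, norm_neg]
      refine (mul_le_of_le_one_left (by positivity) (Real.abs_sin_le_one θ)).trans ?_
      exact mul_le_mul_of_nonneg_left (hw _) (abs_nonneg _)
    · rw [norm_mul, norm_mul]
      refine (mul_le_of_le_one_left (by positivity) (Real.abs_cos_le_one θ)).trans ?_
      exact mul_le_mul_of_nonneg_left (hw _) (abs_nonneg _)
  have hpd : ∀ θ g, HasDerivAt (fun θ => F (rotPath A B θ g)) (D θ g) θ := by
    intro θ g
    have h1 : HasDerivAt (fun θ => rotPath A B θ g) (-Real.sin θ • A g + Real.cos θ • B g) θ := by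
      simp only [rotPath_apply]
      exact ((Real.hasDerivAt_cos θ).smul_const _).add ((Real.hasDerivAt_sin θ).smul_const _)
    exact (h.deriv _).comp_hasDerivAt θ h1
  have main := (hasDerivAt_integral_of_dominated_loc_of_deriv_le (μ := stdGaussianPi κ)
    (F := fun θ g => F (rotPath A B θ g)) (F' := D) (x₀ := θ) (s := Set.univ) (bound := bd)
    Filter.univ_mem
    (.of_forall fun θ => (h.integrable (rotPath A B θ)).1) (h.integrable _)
    (hDint θ).1 (.of_forall fun g θ _ => hbdle θ g) hbdint
    (.of_forall fun g θ _ => hpd θ g)).2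
  refine main.congr_deriv ?_
  have hint : ∀ k, Integrable (fun g => (-Real.sin θ) * (g k * F' (rotPath A B θ g) (a k))
      + Real.cos θ * (g k * F' (rotPath A B θ g) (b k))) (stdGaussianPi κ) := fun k =>
    ((hint1 θ k (a k)).const_mul _).add ((hint1 θ k (b k)).const_mul _)
  rw [funext (hDsum θ), integral_finsetSum _ fun k _ => hint k, Finset.mul_sum]
  refine Finset.sum_congr rfl fun k _ => ?_
  change _ = Real.sin θ * Real.cos θ *
    ((∫ g, F2 (b k) (rotPath A B θ g) (b k) ∂stdGaussianPi κ) -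
      ∫ g, F2 (a k) (rotPath A B θ g) (a k) ∂stdGaussianPi κ)
  rw [integral_add ((hint1 θ k (a k)).const_mul _) ((hint1 θ k (b k)).const_mul _),
    integral_const_mul, integral_const_mul, h.integral_coord_mul, h.integral_coord_mul]
  have hL : rotPath A B θ (Pi.single k 1) = Real.cos θ • a k + Real.sin θ • b k := rfl
  -- Linearity of `F2` in its first argument is not part of `IsC2Exp`; only its value at `0` is
  -- needed, and uniqueness of derivatives gives it.
  have hF0 : ∀ x v, F2 0 x v = 0 := by
    intro x v
    have h1 := h.deriv2 0 x
    simp only [map_zero] at h1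
    rw [h1.unique (hasFDerivAt_const (0 : ℝ) x)]
    rfl
  rw [hL]
  rcases hAB k with h0 | h0
  · rw [show a k = 0 from h0]
    simp only [hF0, smul_zero, zero_add, map_smul, smul_eq_mul, integral_const_mul,
      integral_zero]
    ring
  · rw [show b k = 0 from h0]
    simp only [hF0, smul_zero, add_zero, map_smul, smul_eq_mul, integral_const_mul,
      integral_zero]
    ring

theorem integral_rotPath_eq (h : IsC2Exp F F' F2) (A B : (κ → ℝ) →L[ℝ] E)
    (hAB : ∀ k, A (Pi.single k 1) = 0 ∨ B (Pi.single k 1) = 0)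
    (hD : ∀ θ, ∑ k,
        ((∫ g, F2 (B (Pi.single k 1)) (rotPath A B θ g) (B (Pi.single k 1)) ∂stdGaussianPi κ)
        - ∫ g, F2 (A (Pi.single k 1)) (rotPath A B θ g) (A (Pi.single k 1)) ∂stdGaussianPi κ) = 0)
    (θ : ℝ) : ∫ g, F (rotPath A B θ g) ∂stdGaussianPi κ = ∫ g, F (A g) ∂stdGaussianPi κ := by
  have := is_const_of_deriv_eq_zero (𝕜 := ℝ)
    (f := fun θ => ∫ g, F (rotPath A B θ g) ∂stdGaussianPi κ)
    (fun θ => (hasDerivAt_integral_rotPath h A B hAB θ).differentiableAt)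
    (fun θ => by rw [(hasDerivAt_integral_rotPath h A B hAB θ).deriv, hD, mul_zero]) θ 0
  simpa [rotPath_apply] using this

/-- Gaussian comparison by interpolation. -/
theorem add_half_le_integral_of_le (h : IsC2Exp F F' F2) (A B : (κ → ℝ) →L[ℝ] E)
    (hAB : ∀ k, A (Pi.single k 1) = 0 ∨ B (Pi.single k 1) = 0) (K : ℝ)
    (hD : ∀ θ, K ≤ ∑ k,
        ((∫ g, F2 (B (Pi.single k 1)) (rotPath A B θ g) (B (Pi.single k 1)) ∂stdGaussianPi κ)
        - ∫ g, F2 (A (Pi.single k 1)) (rotPath A B θ g) (A (Pi.single k 1)) ∂stdGaussianPi κ)) :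
    ∫ g, F (A g) ∂stdGaussianPi κ + K / 2 ≤ ∫ g, F (B g) ∂stdGaussianPi κ := by
  have hd := hasDerivAt_integral_rotPath h A B hAB
  set ψ := fun θ => ∫ g, F (rotPath A B θ g) ∂stdGaussianPi κ with hψ
  -- The correction `K/2 · sin² θ` has derivative `K sin θ cos θ`, the assumed lower bound for the
  -- derivative of `ψ`, and it increases by `K/2` over `[0, π/2]`.
  have hφ : ∀ θ, HasDerivAt (fun θ => ψ θ - K / 2 * Real.sin θ ^ 2) _ θ := fun θ =>
    (hd θ).sub (((Real.hasDerivAt_sin θ).pow 2).const_mul (K / 2))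
  have hmono : MonotoneOn (fun θ => ψ θ - K / 2 * Real.sin θ ^ 2) (Set.Icc 0 (Real.pi / 2)) := by
    refine monotoneOn_of_deriv_nonneg (convex_Icc _ _)
      (fun θ _ => (hφ θ).continuousAt.continuousWithinAt)
      (fun θ _ => (hφ θ).differentiableAt.differentiableWithinAt) fun θ hθ => ?_
    rw [interior_Icc] at hθ
    rw [(hφ θ).deriv]
    have hs : 0 ≤ Real.sin θ := Real.sin_nonneg_of_nonneg_of_le_pi hθ.1.le (by linarith [hθ.2, Real.pi_pos])
    have hc : 0 ≤ Real.cos θ := Real.cos_nonneg_of_neg_pi_div_two_le_of_le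
      (by linarith [hθ.1, Real.pi_pos]) hθ.2.le
    have := mul_le_mul_of_nonneg_left (hD θ) (mul_nonneg hs hc)
    simp only [Nat.cast_ofNat, Nat.reduceSub, pow_one]
    linarith
  have hp := Real.pi_pos
  have := hmono (Set.left_mem_Icc.2 (by positivity)) (Set.right_mem_Icc.2 (by positivity))
    (by positivity : (0:ℝ) ≤ Real.pi / 2)
  simp [hψ, rotPath_apply] at this
  linarith

/-- The form used for Gordon's inequality, where the Hessian comparison holds pointwise.
Concentration needs the averaged form above, because there the lower bound is only constant after
integration. -/
theorem integral_le_integral_of_hessian [MeasurableSpace E] [BorelSpace E] (h : IsC2Exp F F' F2)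
    (A B : (κ → ℝ) →L[ℝ] E) (hAB : ∀ k, A (Pi.single k 1) = 0 ∨ B (Pi.single k 1) = 0)
    (hD : ∀ x, 0 ≤ ∑ k, (F2 (B (Pi.single k 1)) x (B (Pi.single k 1))
      - F2 (A (Pi.single k 1)) x (A (Pi.single k 1)))) :
    ∫ g, F (A g) ∂stdGaussianPi κ ≤ ∫ g, F (B g) ∂stdGaussianPi κ := by
  have := add_half_le_integral_of_le h A B hAB 0 fun θ => ?_
  · simpa using this
  · have h1 := fun k => h.integrable2 (rotPath A B θ) (B (Pi.single k 1)) (B (Pi.single k 1))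
    have h2 := fun k => h.integrable2 (rotPath A B θ) (A (Pi.single k 1)) (A (Pi.single k 1))
    simp only [← integral_sub (h1 _) (h2 _)]
    have h3 : ∀ k, Integrable (fun g =>
        F2 (B (Pi.single k 1)) (rotPath A B θ g) (B (Pi.single k 1)) -
          F2 (A (Pi.single k 1)) (rotPath A B θ g) (A (Pi.single k 1))) (stdGaussianPi κ) :=
      fun k => (h1 k).sub (h2 k)
    rw [← integral_finsetSum _ fun k _ => h3 k]
    exact integral_nonneg fun g => hD _

end Interpolation

/-! ### Selecting blocks of independent coordinates -/

section Reindex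

variable {ι ι' κ : Type*}

/-- The continuous linear map `g ↦ g ∘ e`. -/
def reindexL (e : ι → κ) : (κ → ℝ) →L[ℝ] (ι → ℝ) :=
  ContinuousLinearMap.pi fun i => ContinuousLinearMap.proj (e i)

@[simp] theorem reindexL_apply (e : ι → κ) (g : κ → ℝ) (i : ι) : reindexL e g i = g (e i) := rfl

theorem reindexL_single [DecidableEq ι] [DecidableEq κ] {e : ι → κ} (he : e.Injective) (i : ι) :
    reindexL e (Pi.single (e i) 1) = Pi.single i 1 := by
  ext j
  rw [reindexL_apply, Pi.single_apply, Pi.single_apply]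
  simp only [he.eq_iff]

theorem reindexL_single_of_ne [DecidableEq κ] {e : ι → κ} {k : κ} (hk : ∀ i, e i ≠ k) :
    reindexL e (Pi.single k 1) = 0 := by
  ext j
  rw [reindexL_apply, Pi.single_apply, if_neg (hk j)]
  rfl

variable [Fintype ι] [Fintype ι'] [Fintype κ]

theorem map_eq_stdGaussianPi {S : Type*} [MeasurableSpace S] {P : Measure S}
    [IsProbabilityMeasure P] {X : ι → S → ℝ} (hX : ∀ i, HasLaw (X i) (gaussianReal 0 1) P)
    (hi : iIndepFun X P) : P.map (fun ω i => X i ω) = stdGaussianPi ι := by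
  rw [(iIndepFun_iff_map_fun_eq_pi_map fun i => (hX i).aemeasurable).1 hi, stdGaussianPi]
  simp only [(hX _).map_eq]

theorem measurePreserving_eval_stdGaussianPi (k : κ) :
    MeasurePreserving (fun g : κ → ℝ => g k) (stdGaussianPi κ) (gaussianReal 0 1) :=
  measurePreserving_eval (fun _ : κ => gaussianReal 0 1) k

theorem integral_eval_stdGaussianPi (k : κ) {u : ℝ → ℝ} (hu : Measurable u) :
    ∫ g, u (g k) ∂stdGaussianPi κ = ∫ t, u t ∂gaussianReal 0 1 := by
  have := measurePreserving_eval_stdGaussianPi k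
  rw [← this.map_eq, integral_map this.measurable.aemeasurable hu.aestronglyMeasurable]

theorem measurePreserving_reindexL {e : ι → κ} (he : e.Injective) :
    MeasurePreserving (reindexL e) (stdGaussianPi κ) (stdGaussianPi ι) := by
  refine ⟨(reindexL e).continuous.measurable, ?_⟩
  have h1 : iIndepFun (fun (k : κ) (g : κ → ℝ) => g k) (stdGaussianPi κ) :=
    iIndepFun_pi (X := fun _ => id) fun _ => aemeasurable_id
  refine map_eq_stdGaussianPi (X := fun i (g : κ → ℝ) => g (e i)) (fun i => ?_) (h1.precomp he)
  exact ⟨(measurable_pi_apply _).aemeasurable,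
    (measurePreserving_eval_stdGaussianPi (e i)).map_eq⟩

theorem integral_reindexL {e : ι → κ} (he : e.Injective) {u : (ι → ℝ) → ℝ}
    (hu : AEStronglyMeasurable u (stdGaussianPi ι)) :
    ∫ g, u (reindexL e g) ∂stdGaussianPi κ = ∫ x, u x ∂stdGaussianPi ι := by
  have := measurePreserving_reindexL he
  rw [← this.map_eq] at hu ⊢
  rw [integral_map this.measurable.aemeasurable hu]

/-- Injectivity of `Sum.elim e e'` says that the two blocks are disjoint and without repetition,
hence independent. -/
theorem integral_reindexL_mul {e : ι → κ} {e' : ι' → κ} (he : (Sum.elim e e').Injective)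
    (u : (ι → ℝ) → ℝ) (v : (ι' → ℝ) → ℝ) (hu : Measurable u) (hv : Measurable v) :
    ∫ g, u (reindexL e g) * v (reindexL e' g) ∂stdGaussianPi κ =
      (∫ x, u x ∂stdGaussianPi ι) * ∫ x, v x ∂stdGaussianPi ι' := by
  have h1 := measurePreserving_sumPiEquivProdPi fun _ : ι ⊕ ι' => gaussianReal 0 1
  have h2 := h1.comp (measurePreserving_reindexL he)
  change _ = (∫ x, u x ∂Measure.pi fun _ => gaussianReal 0 1) *
    ∫ x, v x ∂Measure.pi fun _ => gaussianReal 0 1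
  rw [← integral_prod_mul u v, ← h2.map_eq]
  exact (integral_map (f := fun z : (ι → ℝ) × (ι' → ℝ) => u z.1 * v z.2) h2.measurable.aemeasurable
    ((hu.comp measurable_fst).mul (hv.comp measurable_snd)).aestronglyMeasurable).symm

end Reindex

/-! ### Products and exponentials of smooth functions -/

section Products

variable {E E₂ : Type*} [NormedAddCommGroup E] [NormedSpace ℝ E] [NormedAddCommGroup E₂]
  [NormedSpace ℝ E₂]

theorem IsC2Exp.prod_mul {f : E → ℝ} {f' : E → E →L[ℝ] ℝ} {f2 : E → E → E →L[ℝ] ℝ}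
    {h : E₂ → ℝ} {h' : E₂ → E₂ →L[ℝ] ℝ} {h2 : E₂ → E₂ → E₂ →L[ℝ] ℝ}
    (hf : IsC2Exp f f' f2) (hh : IsC2Exp h h' h2) :
    IsC2Exp (fun z : E × E₂ => f z.1 * h z.2)
      (fun z => f z.1 • (h' z.2).comp (.snd ℝ E E₂) + h z.2 • (f' z.1).comp (.fst ℝ E E₂))
      (fun w z => (f z.1 • (h2 w.2 z.2).comp (.snd ℝ E E₂) +
          h' z.2 w.2 • (f' z.1).comp (.fst ℝ E E₂)) +
        (h z.2 • (f2 w.1 z.1).comp (.fst ℝ E E₂) +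
          f' z.1 w.1 • (h' z.2).comp (.snd ℝ E E₂))) where
  deriv z := ((hf.deriv z.1).comp z hasFDerivAt_fst).mul ((hh.deriv z.2).comp z hasFDerivAt_snd)
  deriv2 w z := by
    exact (((hf.deriv z.1).comp z hasFDerivAt_fst).mul
      ((hh.deriv2 w.2 z.2).comp z hasFDerivAt_snd)).add
      (((hh.deriv z.2).comp z hasFDerivAt_snd).mul ((hf.deriv2 w.1 z.1).comp z hasFDerivAt_fst))
  growth := (hf.growth.comp_clm (.fst ℝ E E₂)).mul (hh.growth.comp_clm (.snd ℝ E E₂))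
  growth1 w := ((hf.growth.comp_clm (.fst ℝ E E₂)).mul ((hh.growth1 w.2).comp_clm (.snd ℝ E E₂))).add
    ((hh.growth.comp_clm (.snd ℝ E E₂)).mul ((hf.growth1 w.1).comp_clm (.fst ℝ E E₂)))
  growth2 w v := (((hf.growth.comp_clm (.fst ℝ E E₂)).mul
      ((hh.growth2 w.2 v.2).comp_clm (.snd ℝ E E₂))).add
      (((hh.growth1 w.2).comp_clm (.snd ℝ E E₂)).mul ((hf.growth1 v.1).comp_clm (.fst ℝ E E₂)))).add
    (((hh.growth.comp_clm (.snd ℝ E E₂)).mul ((hf.growth2 w.1 v.1).comp_clm (.fst ℝ E E₂))).add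
      (((hf.growth1 w.1).comp_clm (.fst ℝ E E₂)).mul ((hh.growth1 v.2).comp_clm (.snd ℝ E E₂))))

/-- Linear growth of `f` is required because the exponential of a function of merely exponential
growth would leave the class. -/
theorem IsC2Exp.exp_mul {f : E → ℝ} {f' : E → E →L[ℝ] ℝ} {f2 : E → E → E →L[ℝ] ℝ}
    (hf : IsC2Exp f f' f2) (l : ℝ) (K : ℝ) (hK : ∀ x, |f x| ≤ K * (1 + ‖x‖)) :
    IsC2Exp (fun x => Real.exp (l * f x))
      (fun x => Real.exp (l * f x) • l • f' x)
      (fun w x => Real.exp (l * f x) • l • f2 w x + (l * f' x w) • Real.exp (l * f x) • l • f' x) := by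
  have hexp : ExpGrowth fun x => Real.exp (l * f x) := .exp_of_linear (|l| * K) fun x => by
    calc l * f x ≤ |l| * |f x| := by rw [← abs_mul]; exact le_abs_self _
      _ ≤ |l| * (K * (1 + ‖x‖)) := by gcongr; exact hK x
      _ = _ := by ring
  have hd : ∀ x, HasFDerivAt (fun x => Real.exp (l * f x)) (Real.exp (l * f x) • l • f' x) x :=
    fun x => ((hf.deriv x).const_mul l).exp
  refine ⟨hd, fun w x => ?_, hexp, fun w => ?_, fun w v => ?_⟩
  · exact (hd x).mul ((hf.deriv2 w x).const_mul l)
  · exact hexp.mul ((ExpGrowth.const l).mul (hf.growth1 w))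
  · exact (hexp.mul ((ExpGrowth.const l).mul (hf.growth2 w v))).add
      (((ExpGrowth.const l).mul (hf.growth1 w)).mul
        (hexp.mul ((ExpGrowth.const l).mul (hf.growth1 v))))

end Products

/-! ### Rotation invariance and Gaussian concentration -/

section Concentration

variable {ι κ : Type*} [Fintype ι] [DecidableEq ι] [Fintype κ]

/-- Rotation invariance of the standard Gaussian law. -/
theorem integral_rotPath_inl_inr {h : (ι → ℝ) → ℝ} {h' : (ι → ℝ) → (ι → ℝ) →L[ℝ] ℝ}
    {h2 : (ι → ℝ) → (ι → ℝ) → (ι → ℝ) →L[ℝ] ℝ} (hh : IsC2Exp h h' h2) (θ : ℝ) :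
    ∫ g, h (rotPath (reindexL Sum.inl) (reindexL Sum.inr) θ g) ∂stdGaussianPi (ι ⊕ ι) =
      ∫ x, h x ∂stdGaussianPi ι := by
  have h1 : ∀ i, reindexL (Sum.inl : ι → ι ⊕ ι) (Pi.single (Sum.inl i) 1) = Pi.single i 1 :=
    reindexL_single Sum.inl_injective
  have h2 : ∀ i, reindexL (Sum.inr : ι → ι ⊕ ι) (Pi.single (Sum.inr i) 1) = Pi.single i 1 :=
    reindexL_single Sum.inr_injective
  have h3 : ∀ i, reindexL (Sum.inl : ι → ι ⊕ ι) (Pi.single (Sum.inr i) 1) = 0 :=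
    fun i => reindexL_single_of_ne (by simp)
  have h4 : ∀ i, reindexL (Sum.inr : ι → ι ⊕ ι) (Pi.single (Sum.inl i) 1) = 0 :=
    fun i => reindexL_single_of_ne (by simp)
  rw [integral_rotPath_eq hh _ _ ?_ ?_,
    integral_reindexL Sum.inl_injective hh.continuous.aestronglyMeasurable]
  · rintro (i | i)
    · exact .inr (h4 i)
    · exact .inl (h3 i)
  -- Both copies contribute the same second derivatives at the same point, so the interpolation
  -- derivative is zero.
  · intro θ
    simp only [Fintype.sum_sum_type, h1, h2, h3, h4, map_zero, integral_zero, zero_sub, sub_zero,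
      Finset.sum_neg_distrib, neg_add_cancel]

theorem integral_rotPath_reindexL {e e' : ι → κ} (he : (Sum.elim e e').Injective)
    {h : (ι → ℝ) → ℝ} {h' : (ι → ℝ) → (ι → ℝ) →L[ℝ] ℝ}
    {h2 : (ι → ℝ) → (ι → ℝ) → (ι → ℝ) →L[ℝ] ℝ} (hh : IsC2Exp h h' h2) (θ : ℝ) :
    ∫ g, h (rotPath (reindexL e) (reindexL e') θ g) ∂stdGaussianPi κ =
      ∫ x, h x ∂stdGaussianPi ι := by
  rw [← integral_rotPath_inl_inr hh θ]
  set R : (ι ⊕ ι → ℝ) →L[ℝ] (ι → ℝ) := rotPath (reindexL Sum.inl) (reindexL Sum.inr) θ with hR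
  have h1 : ∀ g, rotPath (reindexL e) (reindexL e') θ g = R (reindexL (Sum.elim e e') g) :=
    fun g => by
      ext i
      simp [hR, rotPath_apply]
  simp only [h1]
  exact integral_reindexL he (u := fun g => h (R g))
    (hh.continuous.comp R.continuous).aestronglyMeasurable

variable {f : (ι → ℝ) → ℝ} {f' : (ι → ℝ) → (ι → ℝ) →L[ℝ] ℝ}
  {f2 : (ι → ℝ) → (ι → ℝ) → (ι → ℝ) →L[ℝ] ℝ}

/-- Interpolate `f (X) exp (l f (Y))` from `X = Y` to `X`, `Y` independent. The pure second
derivatives cancel and only the cross term `-2 l exp (l f (Y)) ⟨∇f (X), ∇f (Y)⟩` remains, which the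
gradient bound controls. The result is the differential inequality `Z' ≤ (E f + l) Z` for the moment
generating function `Z`. -/
theorem integral_mul_exp_le (hf : IsC2Exp f f' f2) (K : ℝ) (hK : ∀ x, |f x| ≤ K * (1 + ‖x‖))
    (hgrad : ∀ x, ∑ i, (f' x (Pi.single i 1)) ^ 2 ≤ 1) {l : ℝ} (hl : 0 ≤ l) :
    ∫ x, f x * Real.exp (l * f x) ∂stdGaussianPi ι ≤
      (∫ x, f x ∂stdGaussianPi ι + l) * ∫ x, Real.exp (l * f x) ∂stdGaussianPi ι := by
  have hh := hf.exp_mul l K hK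
  have hF := hf.prod_mul hh
  set h : (ι → ℝ) → ℝ := fun x => Real.exp (l * f x) with hhdef
  set e0 : ι → ι ⊕ (ι ⊕ ι) := Sum.inl with he0
  set e1 : ι → ι ⊕ (ι ⊕ ι) := fun i => Sum.inr (Sum.inl i) with he1
  set e2 : ι → ι ⊕ (ι ⊕ ι) := fun i => Sum.inr (Sum.inr i) with he2
  have he0i : e0.Injective := Sum.inl_injective
  have he1i : e1.Injective := Sum.inr_injective.comp Sum.inl_injective
  have he2i : e2.Injective := Sum.inr_injective.comp Sum.inr_injective
  have h00 : ∀ i, reindexL e0 (Pi.single (e0 i) 1) = Pi.single i 1 := reindexL_single he0i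
  have h11 : ∀ i, reindexL e1 (Pi.single (e1 i) 1) = Pi.single i 1 := reindexL_single he1i
  have h22 : ∀ i, reindexL e2 (Pi.single (e2 i) 1) = Pi.single i 1 := reindexL_single he2i
  have h01 : ∀ i, reindexL e0 (Pi.single (e1 i) 1) = 0 :=
    fun i => reindexL_single_of_ne (by simp [he0, he1])
  have h02 : ∀ i, reindexL e0 (Pi.single (e2 i) 1) = 0 :=
    fun i => reindexL_single_of_ne (by simp [he0, he2])
  have h10 : ∀ i, reindexL e1 (Pi.single (e0 i) 1) = 0 :=
    fun i => reindexL_single_of_ne (by simp [he0, he1])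
  have h12 : ∀ i, reindexL e1 (Pi.single (e2 i) 1) = 0 :=
    fun i => reindexL_single_of_ne (by simp [he2, he1])
  have h20 : ∀ i, reindexL e2 (Pi.single (e0 i) 1) = 0 :=
    fun i => reindexL_single_of_ne (by simp [he0, he2])
  have h21 : ∀ i, reindexL e2 (Pi.single (e1 i) 1) = 0 :=
    fun i => reindexL_single_of_ne (by simp [he2, he1])
  set A : (ι ⊕ (ι ⊕ ι) → ℝ) →L[ℝ] (ι → ℝ) × (ι → ℝ) := (reindexL e0).prod (reindexL e0) with hA
  set B : (ι ⊕ (ι ⊕ ι) → ℝ) →L[ℝ] (ι → ℝ) × (ι → ℝ) := (reindexL e1).prod (reindexL e2) with hB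
  have hA0 : ∀ i, A (Pi.single (e0 i) 1) = (Pi.single i 1, Pi.single i 1) := fun i => by
    simp [hA, h00]
  have hA1 : ∀ i, A (Pi.single (e1 i) 1) = 0 := fun i => by simp [hA, h01]
  have hA2 : ∀ i, A (Pi.single (e2 i) 1) = 0 := fun i => by simp [hA, h02]
  have hB0 : ∀ i, B (Pi.single (e0 i) 1) = 0 := fun i => by simp [hB, h10, h20]
  have hB1 : ∀ i, B (Pi.single (e1 i) 1) = (Pi.single i 1, 0) := fun i => by simp [hB, h11, h21]
  have hB2 : ∀ i, B (Pi.single (e2 i) 1) = (0, Pi.single i 1) := fun i => by simp [hB, h12, h22]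
  have hAB : ∀ k, A (Pi.single k 1) = 0 ∨ B (Pi.single k 1) = 0 := by
    rintro (i | i | i)
    · exact .inr (hB0 i)
    · exact .inl (hA1 i)
    · exact .inl (hA2 i)
  have hh0 : ∀ x v, f2 0 x v = 0 := by
    intro x v
    have h1 := hf.deriv2 0 x
    simp only [map_zero] at h1
    rw [h1.unique (hasFDerivAt_const (0 : ℝ) x)]
    rfl
  -- The second component is a rotation of the disjoint blocks `e0` and `e2`, so its law does not
  -- depend on `θ` and the lower bound for the derivative is a true constant.
  have hZ : ∀ θ, ∫ g, h (rotPath A B θ g).2 ∂stdGaussianPi (ι ⊕ (ι ⊕ ι)) =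
      ∫ x, h x ∂stdGaussianPi ι := by
    intro θ
    have hinj : (Sum.elim e0 e2).Injective := by
      rintro (i | i) (j | j) <;> simp [he0, he2]
    exact integral_rotPath_reindexL hinj hh θ
  have main := add_half_le_integral_of_le hF A B hAB (-(2 * l * ∫ x, h x ∂stdGaussianPi ι)) ?_
  · have e3 : ∫ g, f (A g).1 * h (A g).2 ∂stdGaussianPi (ι ⊕ (ι ⊕ ι)) =
        ∫ x, f x * h x ∂stdGaussianPi ι :=
      integral_reindexL he0i (u := fun x => f x * h x)
        (hf.continuous.mul hh.continuous).aestronglyMeasurable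
    have hinj : (Sum.elim e1 e2).Injective := by
      rintro (i | i) (j | j) <;> simp [he1, he2]
    have e4 : ∫ g, f (B g).1 * h (B g).2 ∂stdGaussianPi (ι ⊕ (ι ⊕ ι)) =
        (∫ x, f x ∂stdGaussianPi ι) * ∫ x, h x ∂stdGaussianPi ι :=
      integral_reindexL_mul hinj f h hf.continuous.measurable hh.continuous.measurable
    rw [e3, e4] at main
    linarith
  · intro θ
    set R := rotPath A B θ with hR
    rw [← hZ θ, ← integral_const_mul, ← integral_neg]
    change _ ≤ ∑ k : ι ⊕ (ι ⊕ ι), _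
    rw [Fintype.sum_sum_type, Fintype.sum_sum_type, ← Finset.sum_add_distrib,
      ← Finset.sum_add_distrib]
    have hint := fun w v => hF.integrable2 R w v
    have hstep : ∀ i, (∫ g, -(2 * l * (h (R g).2 * (f' (R g).1 (Pi.single i 1) *
        f' (R g).2 (Pi.single i 1)))) ∂stdGaussianPi (ι ⊕ (ι ⊕ ι))) = _ := fun i => by
      have a1 := hint (Pi.single i 1, 0) (Pi.single i 1, 0)
      have a2 := hint (0, Pi.single i 1) (0, Pi.single i 1)
      have a3 := hint (Pi.single i 1, Pi.single i 1) (Pi.single i 1, Pi.single i 1)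
      refine Eq.trans ?_ ((integral_sub (a1.add a2) a3).trans
        (congrArg₂ _ (integral_add a1 a2) rfl))
      refine integral_congr_ae (.of_forall fun g => ?_)
      simp [hhdef, hh0]
      ring
    have hint' : ∀ i, Integrable (fun g => -(2 * l * (h (R g).2 * (f' (R g).1 (Pi.single i 1) *
        f' (R g).2 (Pi.single i 1))))) (stdGaussianPi (ι ⊕ (ι ⊕ ι))) := by
      intro i
      have b1 := hh.continuous.comp (continuous_snd.comp R.continuous)
      have b2 := (hf.continuous1 (Pi.single i 1)).comp (continuous_fst.comp R.continuous)
      have b3 := (hf.continuous1 (Pi.single i 1)).comp (continuous_snd.comp R.continuous)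
      refine ExpGrowth.integrable (.neg (.mul (.const _) (.mul ?_ (.mul ?_ ?_))))
        (continuous_const.mul (b1.mul (b2.mul b3))).neg.aestronglyMeasurable
      · exact hh.growth.comp_clm ((ContinuousLinearMap.snd ℝ _ _).comp R)
      · exact (hf.growth1 _).comp_clm ((ContinuousLinearMap.fst ℝ _ _).comp R)
      · exact (hf.growth1 _).comp_clm ((ContinuousLinearMap.snd ℝ _ _).comp R)
    calc _ ≤ ∫ g, ∑ i, -(2 * l * (h (R g).2 * (f' (R g).1 (Pi.single i 1) *
          f' (R g).2 (Pi.single i 1)))) ∂stdGaussianPi (ι ⊕ (ι ⊕ ι)) := by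
          refine integral_mono ?_ (integrable_finsetSum _ fun i _ => hint' i) fun g => ?_
          · exact ((ExpGrowth.const (2 * l)).mul
              (hh.growth.comp_clm ((ContinuousLinearMap.snd ℝ _ _).comp R))).neg.integrable
              (continuous_const.mul
                (hh.continuous.comp (continuous_snd.comp R.continuous))).neg.aestronglyMeasurable
          · have c1 : ∑ i, f' (R g).1 (Pi.single i 1) * f' (R g).2 (Pi.single i 1) ≤ 1 := by
              calc _ ≤ ∑ i, ((f' (R g).1 (Pi.single i 1)) ^ 2
                    + (f' (R g).2 (Pi.single i 1)) ^ 2) / 2 :=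
                    Finset.sum_le_sum fun i _ => by
                      nlinarith [sq_nonneg (f' (R g).1 (Pi.single i 1) - f' (R g).2 (Pi.single i 1))]
                _ ≤ 1 := by
                  rw [← Finset.sum_div, Finset.sum_add_distrib]
                  linarith [hgrad (R g).1, hgrad (R g).2]
            have c2 : 0 < h (R g).2 := Real.exp_pos _
            simp only [Finset.sum_neg_distrib, ← Finset.mul_sum, neg_le_neg_iff]
            gcongr
            exact mul_le_of_le_one_right c2.le c1
      _ = _ := by
          rw [integral_finsetSum _ fun i _ => hint' i]
          refine Finset.sum_congr rfl fun i _ => ?_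
          rw [hstep i]
          rw [show B (Pi.single (Sum.inl i) 1) = 0 from hB0 i,
            show A (Pi.single (Sum.inl i) 1) = _ from hA0 i,
            show A (Pi.single (Sum.inr (Sum.inl i)) 1) = 0 from hA1 i,
            show B (Pi.single (Sum.inr (Sum.inl i)) 1) = _ from hB1 i,
            show A (Pi.single (Sum.inr (Sum.inr i)) 1) = 0 from hA2 i,
            show B (Pi.single (Sum.inr (Sum.inr i)) 1) = _ from hB2 i]
          simp only [map_zero, integral_zero]
          ring

/-- Herbst's argument: by `integral_mul_exp_le` the function `Z(t) exp (-(t m + t²/2))` is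
non-increasing on `t ≥ 0`, and it equals 1 at `0`. -/
theorem integral_exp_le (hf : IsC2Exp f f' f2) (K : ℝ) (hK : ∀ x, |f x| ≤ K * (1 + ‖x‖))
    (hgrad : ∀ x, ∑ i, (f' x (Pi.single i 1)) ^ 2 ≤ 1) {l : ℝ} (hl : 0 ≤ l) :
    ∫ x, Real.exp (l * f x) ∂stdGaussianPi ι ≤
      Real.exp (l * ∫ x, f x ∂stdGaussianPi ι + l ^ 2 / 2) := by
  set m := ∫ x, f x ∂stdGaussianPi ι with hm
  have hint : ∀ t : ℝ, Integrable (fun x => Real.exp (t * f x)) (stdGaussianPi ι) := fun t =>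
    (hf.exp_mul t K hK).growth.integrable (hf.exp_mul t K hK).continuous.aestronglyMeasurable
  have hset : integrableExpSet f (stdGaussianPi ι) = Set.univ :=
    Set.eq_univ_of_forall hint
  have hd : ∀ t, HasDerivAt (mgf f (stdGaussianPi ι))
      (∫ x, f x * Real.exp (t * f x) ∂stdGaussianPi ι) t := fun t =>
    hasDerivAt_mgf (by rw [hset, interior_univ]; trivial)
  have he : ∀ t, HasDerivAt (fun t : ℝ => Real.exp (-(t * m + t ^ 2 / 2)))
      (Real.exp (-(t * m + t ^ 2 / 2)) * -(m + t)) t := fun t => by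
    have : HasDerivAt (fun t : ℝ => -(t * m + t ^ 2 / 2)) (-(m + t)) t :=
      (((hasDerivAt_id t).mul_const m).add ((hasDerivAt_pow 2 t).div_const 2)).neg.congr_deriv
        (by simp)
    exact this.exp
  have hφ : ∀ t, HasDerivAt
      (fun t => mgf f (stdGaussianPi ι) t * Real.exp (-(t * m + t ^ 2 / 2))) _ t :=
    fun t => (hd t).mul (he t)
  have hanti : AntitoneOn (fun t => mgf f (stdGaussianPi ι) t * Real.exp (-(t * m + t ^ 2 / 2)))
      (Set.Ici 0) := by
    refine antitoneOn_of_deriv_nonpos (convex_Ici 0)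
      (fun t _ => (hφ t).continuousAt.continuousWithinAt)
      (fun t _ => (hφ t).differentiableAt.differentiableWithinAt) fun t ht => ?_
    rw [interior_Ici] at ht
    have h1 := integral_mul_exp_le hf K hK hgrad (le_of_lt ht)
    have h2 := Real.exp_pos (-(t * m + t ^ 2 / 2))
    rw [(hφ t).deriv]
    have h3 : mgf f (stdGaussianPi ι) t = ∫ x, Real.exp (t * f x) ∂stdGaussianPi ι := rfl
    rw [h3]
    nlinarith
  have h0 := hanti Set.self_mem_Ici hl hl
  have h3 : mgf f (stdGaussianPi ι) l = ∫ x, Real.exp (l * f x) ∂stdGaussianPi ι := rfl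
  simp only [mgf_zero, zero_mul, one_mul, h3] at h0
  rw [Real.exp_neg] at h0
  simpa using (mul_inv_le_iff₀ (Real.exp_pos _)).1 h0

/-- Gaussian concentration for smooth functions with gradient bounded by one. -/
theorem measureReal_add_le_le_exp (hf : IsC2Exp f f' f2) (K : ℝ) (hK : ∀ x, |f x| ≤ K * (1 + ‖x‖))
    (hgrad : ∀ x, ∑ i, (f' x (Pi.single i 1)) ^ 2 ≤ 1) {r : ℝ} (hr : 0 ≤ r) :
    (stdGaussianPi ι).real {x | ∫ x, f x ∂stdGaussianPi ι + r ≤ f x} ≤ Real.exp (-(r ^ 2 / 2)) := by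
  have hint : Integrable (fun x => Real.exp (r * f x)) (stdGaussianPi ι) :=
    (hf.exp_mul r K hK).growth.integrable (hf.exp_mul r K hK).continuous.aestronglyMeasurable
  -- Chernoff's bound at the optimal parameter `l = r`.
  refine (measure_ge_le_exp_mul_mgf _ hr hint).trans ?_
  refine (mul_le_mul_of_nonneg_left (integral_exp_le hf K hK hgrad hr) (Real.exp_pos _).le).trans
    (le_of_eq ?_)
  rw [← Real.exp_add]
  congr 1
  ring

end Concentration

/-! ### Closure properties of the smooth class -/

section Calculus

variable {E E₂ : Type*} [NormedAddCommGroup E] [NormedSpace ℝ E] [NormedAddCommGroup E₂]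
  [NormedSpace ℝ E₂]

variable {F G : E → ℝ} {F' G' : E → E →L[ℝ] ℝ} {F2 G2 : E → E → E →L[ℝ] ℝ}

theorem IsC2Exp.comp_clm (h : IsC2Exp F F' F2) (L : E₂ →L[ℝ] E) :
    IsC2Exp (fun x => F (L x)) (fun x => (F' (L x)).comp L) (fun w x => (F2 (L w) (L x)).comp L) where
  deriv x := (h.deriv _).comp x L.hasFDerivAt
  deriv2 _ x := (h.deriv2 _ _).comp x L.hasFDerivAt
  growth := h.growth.comp_clm L
  growth1 _ := (h.growth1 _).comp_clm L
  growth2 _ _ := (h.growth2 _ _).comp_clm L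

theorem IsC2Exp.neg (h : IsC2Exp F F' F2) :
    IsC2Exp (fun x => -F x) (fun x => -F' x) (fun w x => -F2 w x) where
  deriv x := (h.deriv x).neg
  deriv2 w x := (h.deriv2 w x).neg
  growth := h.growth.neg
  growth1 w := (h.growth1 w).neg
  growth2 w v := (h.growth2 w v).neg

theorem IsC2Exp.add (hF : IsC2Exp F F' F2) (hG : IsC2Exp G G' G2) :
    IsC2Exp (fun x => F x + G x) (fun x => F' x + G' x) (fun w x => F2 w x + G2 w x) where
  deriv x := (hF.deriv x).add (hG.deriv x)
  deriv2 w x := (hF.deriv2 w x).add (hG.deriv2 w x)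
  growth := hF.growth.add hG.growth
  growth1 w := (hF.growth1 w).add (hG.growth1 w)
  growth2 w v := (hF.growth2 w v).add (hG.growth2 w v)

theorem IsC2Exp.clm (L : E →L[ℝ] ℝ) : IsC2Exp (fun x => L x) (fun _ => L) (fun _ _ => 0) where
  deriv _ := L.hasFDerivAt
  deriv2 _ _ := hasFDerivAt_const _ _
  growth := .clm L
  growth1 _ := .const _
  growth2 _ _ := .const _

end Calculus

/-! ### The smoothed maximum -/

section LogSumExp

variable {ι : Type*} [Fintype ι]

/-- The smoothed maximum `β⁻¹ log ∑ exp (β v_i)`. -/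
def lse (β : ℝ) (v : ι → ℝ) : ℝ := β⁻¹ * Real.log (∑ i, Real.exp (β * v i))

/-- The weights `exp (β v_i) / ∑ exp (β v_k)`. -/
def lseWeight (β : ℝ) (v : ι → ℝ) (i : ι) : ℝ := Real.exp (β * v i) * (∑ k, Real.exp (β * v k))⁻¹

variable [Nonempty ι] {β : ℝ}

theorem sum_exp_pos (β : ℝ) (v : ι → ℝ) : 0 < ∑ i, Real.exp (β * v i) :=
  Finset.sum_pos (fun _ _ => Real.exp_pos _) Finset.univ_nonempty

theorem lseWeight_nonneg (β : ℝ) (v : ι → ℝ) (i : ι) : 0 ≤ lseWeight β v i :=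
  mul_nonneg (Real.exp_pos _).le (inv_nonneg.2 (sum_exp_pos β v).le)

theorem sum_lseWeight (β : ℝ) (v : ι → ℝ) : ∑ i, lseWeight β v i = 1 := by
  unfold lseWeight
  rw [← Finset.sum_mul, mul_inv_cancel₀ (sum_exp_pos β v).ne']

theorem lseWeight_le_one (β : ℝ) (v : ι → ℝ) (i : ι) : lseWeight β v i ≤ 1 := by
  rw [← sum_lseWeight β v]
  exact Finset.single_le_sum (fun i _ => lseWeight_nonneg β v i) (Finset.mem_univ i)

theorem le_lse (hβ : 0 < β) (v : ι → ℝ) (i : ι) : v i ≤ lse β v := by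
  have h1 : Real.exp (β * v i) ≤ ∑ k, Real.exp (β * v k) :=
    Finset.single_le_sum (f := fun k => Real.exp (β * v k)) (fun _ _ => (Real.exp_pos _).le)
      (Finset.mem_univ i)
  have h2 := (Real.le_log_iff_exp_le (sum_exp_pos β v)).2 h1
  unfold lse
  rw [← div_eq_inv_mul, le_div_iff₀ hβ]
  linarith

theorem lse_le (hβ : 0 < β) {v : ι → ℝ} {c : ℝ} (h : ∀ i, v i ≤ c) :
    lse β v ≤ c + β⁻¹ * Real.log (Fintype.card ι) := by
  have h1 : ∑ k, Real.exp (β * v k) ≤ Fintype.card ι * Real.exp (β * c) := by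
    calc _ ≤ ∑ _k : ι, Real.exp (β * c) := Finset.sum_le_sum fun k _ =>
          Real.exp_le_exp.2 (mul_le_mul_of_nonneg_left (h k) hβ.le)
      _ = _ := by simp
  have h2 := Real.log_le_log (sum_exp_pos β v) h1
  have hc : (Fintype.card ι : ℝ) ≠ 0 := by exact_mod_cast Fintype.card_ne_zero
  rw [Real.log_mul hc (Real.exp_pos _).ne', Real.log_exp] at h2
  unfold lse
  calc β⁻¹ * Real.log (∑ i, Real.exp (β * v i))
      ≤ β⁻¹ * (Real.log (Fintype.card ι) + β * c) :=
        mul_le_mul_of_nonneg_left h2 (inv_nonneg.2 hβ.le)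
    _ = _ := by field_simp; ring

theorem abs_lse_le (hβ : 0 < β) (v : ι → ℝ) :
    |lse β v| ≤ ∑ i, |v i| + β⁻¹ * Real.log (Fintype.card ι) := by
  have hs : ∀ i, |v i| ≤ ∑ i, |v i| := fun i =>
    Finset.single_le_sum (f := fun i => |v i|) (fun _ _ => abs_nonneg _) (Finset.mem_univ i)
  have h0 : 0 ≤ β⁻¹ * Real.log (Fintype.card ι) :=
    mul_nonneg (inv_nonneg.2 hβ.le) (Real.log_natCast_nonneg _)
  obtain ⟨i⟩ := ‹Nonempty ι›
  have : Nonempty ι := ⟨i⟩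
  refine abs_le.2 ⟨?_, lse_le hβ fun i => (le_abs_self _).trans (hs i)⟩
  have := le_lse hβ v i
  linarith [neg_abs_le (v i), hs i]

theorem lse_add_const (hβ : 0 < β) (v : ι → ℝ) (c : ℝ) :
    lse β (fun i => v i + c) = lse β v + c := by
  have : ∑ i, Real.exp (β * (v i + c)) = (∑ i, Real.exp (β * v i)) * Real.exp (β * c) := by
    rw [Finset.sum_mul]
    exact Finset.sum_congr rfl fun i _ => by rw [← Real.exp_add]; ring_nf
  unfold lse
  rw [this, Real.log_mul (sum_exp_pos β v).ne' (Real.exp_pos _).ne', Real.log_exp]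
  field_simp

variable {E : Type*} [NormedAddCommGroup E] [NormedSpace ℝ E]

/-- The weights `q_i` have derivative `β q_i (u_i' - ∑ q_k u_k')`, so the Hessian is the average of
the Hessians plus `β` times the variance of the gradients under `q`. -/
theorem IsC2Exp.lse {u : ι → E → ℝ} {u' : ι → E → E →L[ℝ] ℝ} {u2 : ι → E → E → E →L[ℝ] ℝ}
    (hβ : 0 < β) (h : ∀ i, IsC2Exp (u i) (u' i) (u2 i)) :
    IsC2Exp (fun x => lse β fun i => u i x)
      (fun x => ∑ i, lseWeight β (fun i => u i x) i • u' i x)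
      (fun w x => ∑ i, (lseWeight β (fun i => u i x) i • u2 i w x + u' i x w •
        (β * lseWeight β (fun i => u i x) i) •
          (u' i x - ∑ k, lseWeight β (fun i => u i x) k • u' k x))) := by
  have hS : ∀ x, HasFDerivAt (fun x => ∑ i, Real.exp (β * u i x))
      (∑ i, Real.exp (β * u i x) • β • u' i x) x := fun x =>
    HasFDerivAt.fun_sum fun i _ => (((h i).deriv x).const_mul β).exp
  have hpos : ∀ x, 0 < ∑ i, Real.exp (β * u i x) := fun x => sum_exp_pos β fun i => u i x
  have hq : ∀ i x, HasFDerivAt (fun x => lseWeight β (fun i => u i x) i)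
      ((β * lseWeight β (fun i => u i x) i) •
          (u' i x - ∑ k, lseWeight β (fun i => u i x) k • u' k x)) x := by
    intro i x
    have h1 := ((((h i).deriv x).const_mul β).exp).mul ((hasDerivAt_inv (hpos x).ne').comp_hasFDerivAt x (hS x))
    refine h1.congr_fderiv ?_
    ext v
    simp only [lseWeight, add_apply, smul_apply,
      sub_apply, Function.comp_apply, smul_eq_mul,
      sum_apply]
    have e1 : ∑ k, Real.exp (β * u k x) * (∑ k, Real.exp (β * u k x))⁻¹ * u' k x v =
        (∑ k, Real.exp (β * u k x))⁻¹ * ∑ k, Real.exp (β * u k x) * u' k x v := by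
      rw [Finset.mul_sum]
      exact Finset.sum_congr rfl fun k _ => by ring
    have e2 : ∑ k, Real.exp (β * u k x) * (β * u' k x v) =
        β * ∑ k, Real.exp (β * u k x) * u' k x v := by
      rw [Finset.mul_sum]
      exact Finset.sum_congr rfl fun k _ => by ring
    rw [e1, e2]
    have := (hpos x).ne'
    field_simp
    ring
  have hqg : ∀ i, ExpGrowth fun x => lseWeight β (fun i => u i x) i := fun i =>
    .of_le_const 1 fun x => by
      rw [Real.norm_of_nonneg (lseWeight_nonneg _ _ _)]
      exact lseWeight_le_one _ _ _
  have hg1 : ∀ w, ExpGrowth fun x => ∑ i, lseWeight β (fun i => u i x) i * u' i x w :=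
    fun w => .sum _ fun i _ => (hqg i).mul ((h i).growth1 w)
  refine ⟨fun x => ?_, fun w x => ?_, ?_, fun w => ?_, fun w v => ?_⟩
  · have h1 := ((hS x).log (hpos x).ne').const_mul β⁻¹
    refine h1.congr_fderiv ?_
    ext v
    simp only [lseWeight, smul_apply, smul_eq_mul,
      sum_apply, Finset.mul_sum]
    refine Finset.sum_congr rfl fun k _ => ?_
    have := (hpos x).ne'
    field_simp
  · simp only [sum_apply, smul_apply, smul_eq_mul]
    exact HasFDerivAt.fun_sum fun i _ => (hq i x).mul ((h i).deriv2 w x)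
  · have h1 : ExpGrowth fun x => ∑ i, ‖u i x‖ + β⁻¹ * Real.log (Fintype.card ι) :=
      (ExpGrowth.sum _ fun i _ => (h i).growth.norm).add (.const _)
    exact h1.mono fun x => (abs_lse_le hβ _).trans (le_abs_self _)
  · simpa only [sum_apply, smul_apply, smul_eq_mul]
      using hg1 w
  · simp only [sum_apply, smul_apply, smul_eq_mul,
      add_apply, sub_apply]
    exact .sum _ fun i _ => ((hqg i).mul ((h i).growth2 w v)).add
      (((h i).growth1 w).mul (((ExpGrowth.const β).mul (hqg i)).mul
        (((h i).growth1 v).sub (hg1 v))))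

end LogSumExp

/-! ### The smoothed norm -/

section SmoothNorm

variable {V : Type*} [NormedAddCommGroup V] {δ : ℝ}

/-- The smoothed norm `√(‖a‖² + δ²)`. -/
def smoothNorm (δ : ℝ) (a : V) : ℝ := Real.sqrt (‖a‖ ^ 2 + δ ^ 2)

theorem smoothNorm_pos (hδ : 0 < δ) (a : V) : 0 < smoothNorm δ a :=
  Real.sqrt_pos.2 (by positivity)

theorem smoothNorm_sq (δ : ℝ) (a : V) : smoothNorm δ a ^ 2 = ‖a‖ ^ 2 + δ ^ 2 :=
  Real.sq_sqrt (by positivity)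

theorem norm_le_smoothNorm (δ : ℝ) (a : V) : ‖a‖ ≤ smoothNorm δ a :=
  Real.le_sqrt_of_sq_le (by nlinarith [sq_nonneg δ])

theorem smoothNorm_le (hδ : 0 ≤ δ) (a : V) : smoothNorm δ a ≤ ‖a‖ + δ :=
  Real.sqrt_le_iff.2 ⟨by positivity, by nlinarith [mul_nonneg (norm_nonneg a) hδ]⟩

variable [InnerProductSpace ℝ V]

theorem isC2Exp_smoothNorm (hδ : 0 < δ) :
    IsC2Exp (smoothNorm δ : V → ℝ) (fun a => (smoothNorm δ a)⁻¹ • innerSL ℝ a)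
      (fun w a => (smoothNorm δ a)⁻¹ • innerSL ℝ w +
        inner ℝ a w • (-((smoothNorm δ a) ^ 2)⁻¹) • (smoothNorm δ a)⁻¹ • innerSL ℝ a) := by
  have hd : ∀ a : V, HasFDerivAt (smoothNorm δ) ((smoothNorm δ a)⁻¹ • innerSL ℝ a) a := by
    intro a
    have h1 : HasFDerivAt (fun a : V => ‖a‖ ^ 2 + δ ^ 2) (2 • innerSL ℝ a) a :=
      (hasStrictFDerivAt_norm_sq a).hasFDerivAt.add_const _
    refine (h1.sqrt (by positivity)).congr_fderiv ?_
    ext v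
    simp only [smul_apply, smul_eq_mul, nsmul_eq_mul, smoothNorm]
    have : Real.sqrt (‖a‖ ^ 2 + δ ^ 2) ≠ 0 := (smoothNorm_pos hδ a).ne'
    push_cast
    field_simp
  have hinv : ∀ a : V, (smoothNorm δ a)⁻¹ ≤ δ⁻¹ := fun a =>
    inv_anti₀ hδ (Real.le_sqrt_of_sq_le (by nlinarith [sq_nonneg ‖a‖]))
  have hinvg : ExpGrowth fun a : V => (smoothNorm δ a)⁻¹ := .of_le_const δ⁻¹ fun a => by
    rw [Real.norm_of_nonneg (inv_nonneg.2 (smoothNorm_pos hδ a).le)]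
    exact hinv a
  have hin : ∀ w : V, ExpGrowth fun a : V => inner ℝ a w := fun w =>
    (ExpGrowth.clm (innerSL ℝ w)).mono fun a => by
      rw [innerSL_apply_apply, real_inner_comm]
  refine ⟨hd, fun w a => ?_, ?_, fun w => ?_, fun w v => ?_⟩
  · have h1 : HasFDerivAt (fun a : V => inner ℝ a w) (innerSL ℝ w) a := by
      refine (innerSL ℝ w).hasFDerivAt.congr_of_eventuallyEq (.of_forall fun a => ?_)
      rw [innerSL_apply_apply, real_inner_comm]
    have h2 := ((hasDerivAt_inv (smoothNorm_pos hδ a).ne').comp_hasFDerivAt a (hd a)).mul h1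
    simp only [smul_apply, innerSL_apply_apply, smul_eq_mul]
    refine h2.congr_fderiv ?_
    ext v
    simp
  · refine .of_linear (1 + δ) fun a => ?_
    rw [Real.norm_of_nonneg (smoothNorm_pos hδ a).le]
    nlinarith [smoothNorm_le hδ.le a, norm_nonneg a, mul_nonneg hδ.le (norm_nonneg a)]
  · exact hinvg.mul (hin w)
  · simp only [add_apply, smul_apply, innerSL_apply_apply,
      smul_eq_mul]
    refine (hinvg.mul (.const _)).add ((hin w).mul (.mul (.neg ?_) (hinvg.mul (hin v))))
    exact (hinvg.mul hinvg).mono fun a => by rw [pow_two, mul_inv]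

end SmoothNorm

/-! ### The variance inequality behind Gordon's comparison -/

section Algebra

variable {ι μ ν : Type*} [Fintype ι] [Fintype μ] [Fintype ν]

/-- The variance of `a` under the weights `q`. -/
def weightedVar (q a : ι → ℝ) : ℝ := ∑ i, q i * (a i * (a i - ∑ k, q k * a k))

/-- Writing the variance over pairs of indices reduces an inequality between variances to one
between squared distances, pair by pair. -/
theorem weightedVar_eq {q : ι → ℝ} (hq : ∑ i, q i = 1) (a : ι → ℝ) :
    weightedVar q a = ∑ i, ∑ k, q i * q k * ((a i - a k) ^ 2 / 2) := by
  have h1 : ∀ i k, q i * q k * ((a i - a k) ^ 2 / 2) =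
      (q i * a i ^ 2 / 2) * q k + (q i / 2) * (q k * a k ^ 2) - (q i * a i) * (q k * a k) :=
    fun i k => by ring
  simp only [h1, Finset.sum_add_distrib, Finset.sum_sub_distrib, ← Finset.mul_sum, hq,
    ← Finset.sum_mul, ← Finset.sum_div]
  simp only [weightedVar, mul_sub, Finset.sum_sub_distrib, ← mul_assoc, ← Finset.sum_mul]
  have : ∀ i, q i * a i * a i = q i * a i ^ 2 := fun i => by ring
  simp only [this]
  ring

theorem sum_weightedVar_eq {q : ι → ℝ} (hq : ∑ i, q i = 1) (a : μ → ι → ℝ) :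
    ∑ t, weightedVar q (a t) = ∑ i, ∑ k, q i * q k * ((∑ t, (a t i - a t k) ^ 2) / 2) := by
  simp only [weightedVar_eq hq]
  rw [Finset.sum_comm]
  refine Finset.sum_congr rfl fun i _ => ?_
  rw [Finset.sum_comm]
  refine Finset.sum_congr rfl fun k _ => ?_
  rw [← Finset.mul_sum, Finset.sum_div]

theorem weightedVar_neg (q a : ι → ℝ) : weightedVar q (fun i => -a i) = weightedVar q a := by
  simp only [weightedVar, mul_neg, Finset.sum_neg_distrib]
  exact Finset.sum_congr rfl fun i _ => by ring

theorem weightedVar_const {q : ι → ℝ} (hq : ∑ i, q i = 1) (c : ℝ) :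
    weightedVar q (fun _ => c) = 0 := by
  simp [weightedVar_eq hq]

theorem sum_mul_le_one {x y : μ → ℝ} (hx : ∑ p, x p ^ 2 ≤ 1) (hy : ∑ p, y p ^ 2 ≤ 1) :
    ∑ p, x p * y p ≤ 1 := by
  calc ∑ p, x p * y p ≤ ∑ p, (x p ^ 2 + y p ^ 2) / 2 :=
        Finset.sum_le_sum fun p _ => by nlinarith [sq_nonneg (x p - y p)]
    _ ≤ 1 := by rw [← Finset.sum_div, Finset.sum_add_distrib]; linarith

theorem sum_prod_mul_mul (a : μ → ℝ) (b : ν → ℝ) :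
    ∑ r : μ × ν, b r.2 * a r.1 = (∑ q, b q) * ∑ p, a p := by
  rw [Fintype.sum_prod_type, Finset.sum_mul_sum, Finset.sum_comm]

/-- For each pair `i, k` the right side minus the left side is `(1 - ⟨z_i, z_k⟩)(1 - ⟨n_i, n_k⟩)`
times a non-negative weight; both factors are non-negative because the vectors have norm at most 1.
-/
theorem weightedVar_gordon {q : ι → ℝ} (hq0 : ∀ i, 0 ≤ q i) (hq : ∑ i, q i = 1)
    {n : ι → μ → ℝ} {z : ι → ν → ℝ} (hn : ∀ i, ∑ p, n i p ^ 2 ≤ 1) (hz : ∀ i, ∑ r, z i r ^ 2 = 1) :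
    ∑ w : μ × ν, weightedVar q (fun i => z i w.2 * n i w.1) ≤
      ∑ p, weightedVar q (fun i => n i p) + ∑ r, weightedVar q (fun i => z i r) := by
  rw [sum_weightedVar_eq hq, sum_weightedVar_eq hq, sum_weightedVar_eq hq, ← Finset.sum_add_distrib]
  refine Finset.sum_le_sum fun i _ => ?_
  rw [← Finset.sum_add_distrib]
  refine Finset.sum_le_sum fun k _ => ?_
  rw [← mul_add]
  refine mul_le_mul_of_nonneg_left ?_ (mul_nonneg (hq0 i) (hq0 k))
  have e1 : ∑ w : μ × ν, (z i w.2 * n i w.1 - z k w.2 * n k w.1) ^ 2 =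
      ∑ p, n i p ^ 2 + ∑ p, n k p ^ 2 - 2 * ((∑ r, z i r * z k r) * ∑ p, n i p * n k p) := by
    have : ∀ w : μ × ν, (z i w.2 * n i w.1 - z k w.2 * n k w.1) ^ 2 =
        z i w.2 ^ 2 * n i w.1 ^ 2 + z k w.2 ^ 2 * n k w.1 ^ 2 -
          2 * ((z i w.2 * z k w.2) * (n i w.1 * n k w.1)) := fun w => by ring
    simp only [this, Finset.sum_add_distrib, Finset.sum_sub_distrib, ← Finset.mul_sum]
    rw [sum_prod_mul_mul (fun p => n i p ^ 2) fun r => z i r ^ 2,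
      sum_prod_mul_mul (fun p => n k p ^ 2) fun r => z k r ^ 2,
      sum_prod_mul_mul (fun p => n i p * n k p) fun r => z i r * z k r, hz, hz]
    ring
  have e2 : ∑ p, (n i p - n k p) ^ 2 =
      ∑ p, n i p ^ 2 + ∑ p, n k p ^ 2 - 2 * ∑ p, n i p * n k p := by
    rw [Finset.mul_sum, ← Finset.sum_add_distrib, ← Finset.sum_sub_distrib]
    exact Finset.sum_congr rfl fun p _ => by ring
  have e3 : ∑ r, (z i r - z k r) ^ 2 = 2 - 2 * ∑ r, z i r * z k r := by
    have : ∑ r, (z i r - z k r) ^ 2 =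
        ∑ r, z i r ^ 2 + ∑ r, z k r ^ 2 - 2 * ∑ r, z i r * z k r := by
      rw [Finset.mul_sum, ← Finset.sum_add_distrib, ← Finset.sum_sub_distrib]
      exact Finset.sum_congr rfl fun p _ => by ring
    rw [this, hz, hz]; ring
  rw [e1, e2, e3]
  nlinarith [sum_mul_le_one (hn i) (hn k), sum_mul_le_one (hz i).le (hz k).le]

end Algebra

/-! ### Gordon's comparison inequality -/

section Gordon

variable {ι μ ν : Type*} [Fintype μ] [Fintype ν]

/-- Families of pairs of a vector and a number. -/
abbrev PairFamily (ι μ : Type*) : Type _ := ι → EuclideanSpace ℝ μ × ℝ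

/-- The vector of the `i`-th pair. -/
def vecL (μ : Type*) [Fintype μ] (i : ι) : PairFamily ι μ →L[ℝ] EuclideanSpace ℝ μ :=
  (ContinuousLinearMap.fst ℝ _ _).comp (ContinuousLinearMap.proj i)

/-- The number of the `i`-th pair. -/
def numL (μ : Type*) [Fintype μ] (i : ι) : PairFamily ι μ →L[ℝ] ℝ :=
  (ContinuousLinearMap.snd ℝ _ _).comp (ContinuousLinearMap.proj i)

@[simp] theorem vecL_apply (i : ι) (x : PairFamily ι μ) : vecL μ i x = (x i).1 := rfl

@[simp] theorem numL_apply (i : ι) (x : PairFamily ι μ) : numL μ i x = (x i).2 := rfl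

/-- Functions on `μ` as vectors of Euclidean space. -/
def toEucL (μ : Type*) [Fintype μ] : (μ → ℝ) →L[ℝ] EuclideanSpace ℝ μ :=
  ((PiLp.continuousLinearEquiv 2 ℝ fun _ : μ => ℝ).symm : (μ → ℝ) →L[ℝ] EuclideanSpace ℝ μ)

@[simp] theorem toEucL_apply (g : μ → ℝ) : toEucL μ g = WithLp.toLp 2 g := rfl

/-- The family `(M z_i, 0)`. -/
def matFamily (μ : Type*) [Fintype μ] (z : ι → ν → ℝ) : (μ × ν → ℝ) →L[ℝ] PairFamily ι μ :=
  .pi fun i => ((toEucL μ).comp (.pi fun p => ∑ r, z i r • .proj (p, r))).prod 0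

theorem matFamily_apply (z : ι → ν → ℝ) (g : μ × ν → ℝ) (i : ι) :
    matFamily μ z g i = (WithLp.toLp 2 fun p => ∑ r, g (p, r) * z i r, 0) := by
  ext p
  · simp [matFamily, sum_apply, smul_apply, mul_comm]
  · rfl

/-- The family `(M z_i, γ)`. -/
def gordonLeft (μ : Type*) [Fintype μ] (z : ι → ν → ℝ) :
    ((μ × ν) ⊕ (Unit ⊕ (μ ⊕ ν)) → ℝ) →L[ℝ] PairFamily ι μ :=
  (matFamily μ z).comp (reindexL Sum.inl) +
    .pi fun _ => (0 : _ →L[ℝ] EuclideanSpace ℝ μ).prod (.proj (Sum.inr (Sum.inl ())))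

/-- The family `(h, ⟨g, z_i⟩)`. -/
def gordonRight (μ : Type*) [Fintype μ] (z : ι → ν → ℝ) :
    ((μ × ν) ⊕ (Unit ⊕ (μ ⊕ ν)) → ℝ) →L[ℝ] PairFamily ι μ :=
  .pi fun i => ((toEucL μ).comp (reindexL fun p => Sum.inr (Sum.inr (Sum.inl p)))).prod
    (∑ r, z i r • .proj (Sum.inr (Sum.inr (Sum.inr r))))

theorem gordonLeft_apply (z : ι → ν → ℝ) (g : (μ × ν) ⊕ (Unit ⊕ (μ ⊕ ν)) → ℝ) (i : ι) :
    gordonLeft μ z g i =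
      (WithLp.toLp 2 fun p => ∑ r, g (Sum.inl (p, r)) * z i r, g (Sum.inr (Sum.inl ()))) := by
  have : gordonLeft μ z g i = matFamily μ z (reindexL Sum.inl g) i +
    (0, g (Sum.inr (Sum.inl ()))) := rfl
  rw [this, matFamily_apply]
  simp

theorem gordonRight_apply (z : ι → ν → ℝ) (g : (μ × ν) ⊕ (Unit ⊕ (μ ⊕ ν)) → ℝ) (i : ι) :
    gordonRight μ z g i =
      (WithLp.toLp 2 fun p => g (Sum.inr (Sum.inr (Sum.inl p))),
        ∑ r, g (Sum.inr (Sum.inr (Sum.inr r))) * z i r) := by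
  ext p
  · simp [gordonRight]
  · simp [gordonRight, sum_apply, smul_apply, mul_comm]

section Basis

variable [DecidableEq μ] [DecidableEq ν]

theorem gordonLeft_single_inl (z : ι → ν → ℝ) (w : μ × ν) :
    gordonLeft μ z (Pi.single (Sum.inl w) 1) =
      fun i => (EuclideanSpace.single w.1 (z i w.2), 0) := by
  obtain ⟨p, r⟩ := w
  ext i p'
  · rw [gordonLeft_apply]
    by_cases h : p' = p
    · subst h
      simp [Pi.single_apply]
    · simp [h]
  · simp [gordonLeft_apply]

theorem gordonLeft_single_unit (z : ι → ν → ℝ) :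
    gordonLeft μ z (Pi.single (Sum.inr (Sum.inl ())) 1) = fun _ => (0, 1) := by
  ext i p' <;> simp [gordonLeft_apply]

theorem gordonLeft_single_inr (z : ι → ν → ℝ) (t : μ ⊕ ν) :
    gordonLeft μ z (Pi.single (Sum.inr (Sum.inr t)) 1) = 0 := by
  ext i p' <;> simp [gordonLeft_apply]

theorem gordonRight_single_inl (z : ι → ν → ℝ) (w : μ × ν) :
    gordonRight μ z (Pi.single (Sum.inl w) 1) = 0 := by
  ext i p' <;> simp [gordonRight_apply]

theorem gordonRight_single_unit (z : ι → ν → ℝ) :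
    gordonRight μ z (Pi.single (Sum.inr (Sum.inl ())) 1) = 0 := by
  ext i p' <;> simp [gordonRight_apply]

theorem gordonRight_single_vec (z : ι → ν → ℝ) (p : μ) :
    gordonRight μ z (Pi.single (Sum.inr (Sum.inr (Sum.inl p))) 1) =
      fun _ => (EuclideanSpace.single p 1, 0) := by
  ext i p'
  · simp [gordonRight_apply, Pi.single_apply]
  · simp [gordonRight_apply]

theorem gordonRight_single_num (z : ι → ν → ℝ) (r : ν) :
    gordonRight μ z (Pi.single (Sum.inr (Sum.inr (Sum.inr r))) 1) = fun i => (0, z i r) := by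
  ext i p'
  · simp [gordonRight_apply]
  · simp [gordonRight_apply, Pi.single_apply]

end Basis

variable {β δ : ℝ}

/-- The gradient of the smoothed norm of the `i`-th vector. -/
def unitVec (δ : ℝ) (x : PairFamily ι μ) (i : ι) (p : μ) : ℝ :=
  (smoothNorm δ (x i).1)⁻¹ * (x i).1 p

theorem sum_unitVec_sq_le (hδ : 0 < δ) (x : PairFamily ι μ) (i : ι) :
    ∑ p, unitVec δ x i p ^ 2 ≤ 1 := by
  have h0 := smoothNorm_pos hδ (x i).1
  simp only [unitVec, mul_pow]
  rw [← Finset.mul_sum, inv_pow, ← EuclideanSpace.real_norm_sq_eq, ← div_eq_inv_mul,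
    div_le_one (by positivity)]
  exact pow_le_pow_left₀ (norm_nonneg _) (norm_le_smoothNorm _ _) 2

variable [Fintype ι]

/-- The smoothed maximum of `-‖a_i‖ + b_i`. -/
def gordonFun (β δ : ℝ) (x : PairFamily ι μ) : ℝ :=
  lse β fun i => -smoothNorm δ (x i).1 + (x i).2

/-- The weights of `gordonFun`. -/
def gordonWeight (β δ : ℝ) (x : PairFamily ι μ) (i : ι) : ℝ :=
  lseWeight β (fun i => -smoothNorm δ (x i).1 + (x i).2) i

variable [Nonempty ι]

/-- Only the gradient and the diagonal of the Hessian are exposed: concentration uses the former and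
the comparison the latter. -/
theorem exists_isC2Exp_gordonFun (hβ : 0 < β) (hδ : 0 < δ) :
    ∃ (G' : PairFamily ι μ → PairFamily ι μ →L[ℝ] ℝ)
      (G2 : PairFamily ι μ → PairFamily ι μ → PairFamily ι μ →L[ℝ] ℝ),
      IsC2Exp (gordonFun β δ) G' G2 ∧
      (∀ x w, G' x w = ∑ i, gordonWeight β δ x i *
        (-((smoothNorm δ (x i).1)⁻¹ * inner ℝ (x i).1 (w i).1) + (w i).2)) ∧
      ∀ x w, G2 w x w = β * weightedVar (gordonWeight β δ x) (fun i =>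
          -((smoothNorm δ (x i).1)⁻¹ * inner ℝ (x i).1 (w i).1) + (w i).2) -
        ∑ i, gordonWeight β δ x i * ((smoothNorm δ (x i).1)⁻¹ * inner ℝ (w i).1 (w i).1 -
          ((smoothNorm δ (x i).1) ^ 3)⁻¹ * inner ℝ (x i).1 (w i).1 ^ 2) := by
  have hu := fun i : ι => ((isC2Exp_smoothNorm (V := EuclideanSpace ℝ μ) hδ).comp_clm
    (vecL μ i)).neg.add (.clm (numL μ i))
  refine ⟨_, _, IsC2Exp.lse hβ hu, fun x w => ?_, fun x w => ?_⟩
  · simp [gordonWeight, sum_apply, smul_apply, mul_add]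
  · simp only [sum_apply, smul_apply, add_apply, sub_apply, neg_apply,
      ContinuousLinearMap.comp_apply, innerSL_apply_apply, smul_eq_mul, vecL_apply, numL_apply,
      add_zero, weightedVar]
    rw [Finset.mul_sum, ← Finset.sum_sub_distrib]
    refine Finset.sum_congr rfl fun i _ => ?_
    have := (smoothNorm_pos hδ (x i).1).ne'
    simp only [gordonWeight]
    field_simp
    ring

/-- Gordon's inequality for the smoothed minimum of `‖M z_i‖`. -/
theorem integral_gordonFun_le (hβ : 0 < β) (hδ : 0 < δ) {z : ι → ν → ℝ}
    (hz : ∀ i, ∑ r, z i r ^ 2 = 1) :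
    ∫ g, gordonFun β δ (matFamily μ z g) ∂stdGaussianPi (μ × ν) ≤
      ∫ g, gordonFun β δ (gordonRight μ z g) ∂stdGaussianPi ((μ × ν) ⊕ (Unit ⊕ (μ ⊕ ν))) := by
  classical
  obtain ⟨G', G2, hG, -, hG2⟩ := exists_isC2Exp_gordonFun (ι := ι) (μ := μ) hβ hδ
  have key := integral_le_integral_of_hessian hG (gordonLeft μ z) (gordonRight μ z) ?_ ?_
  · refine le_trans (le_of_eq ?_) key
    -- The shared variable `γ` shifts all entries equally, so it adds only its mean, which is zero.
    have h1 : ∀ g, gordonFun β δ (gordonLeft μ z g) =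
        gordonFun β δ (matFamily μ z (reindexL Sum.inl g)) + g (Sum.inr (Sum.inl ())) := by
      intro g
      simp only [gordonFun, gordonLeft_apply, matFamily_apply, reindexL_apply, add_zero]
      exact lse_add_const hβ _ _
    have i1 := hG.integrable ((matFamily μ z).comp
      (reindexL (Sum.inl : μ × ν → (μ × ν) ⊕ (Unit ⊕ (μ ⊕ ν)))))
    have i2 := (IsC2Exp.clm (ContinuousLinearMap.proj (R := ℝ)
      (φ := fun _ : (μ × ν) ⊕ (Unit ⊕ (μ ⊕ ν)) => ℝ) (Sum.inr (Sum.inl ())))).integrable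
      (ContinuousLinearMap.id ℝ _)
    simp only [h1]
    have h2 : ∫ g : (μ × ν) ⊕ (Unit ⊕ (μ ⊕ ν)) → ℝ, g (Sum.inr (Sum.inl ()))
        ∂stdGaussianPi ((μ × ν) ⊕ (Unit ⊕ (μ ⊕ ν))) = 0 := by
      rw [integral_eval_stdGaussianPi (u := fun t => t) _ measurable_id, integral_id_gaussianReal]
    refine Eq.trans ?_ (integral_add i1 i2).symm
    refine Eq.trans ?_ (congrArg₂ (· + ·) (integral_reindexL Sum.inl_injective
      (u := fun g => gordonFun β δ (matFamily μ z g))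
      (hG.continuous.comp (matFamily μ z).continuous).aestronglyMeasurable).symm h2.symm)
    simp
  · rintro (w | u | p | r)
    · exact .inr (gordonRight_single_inl z w)
    · exact .inr (gordonRight_single_unit z)
    · exact .inl (gordonLeft_single_inr z _)
    · exact .inl (gordonLeft_single_inr z _)
  · intro x
    have hq0 : ∀ i, 0 ≤ gordonWeight β δ x i := fun i => lseWeight_nonneg _ _ _
    have hq1 : ∑ i, gordonWeight β δ x i = 1 := sum_lseWeight _ _
    set q := gordonWeight β δ x with hq
    set H : ι → μ → ℝ := fun i p => (smoothNorm δ (x i).1)⁻¹ -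
      ((smoothNorm δ (x i).1) ^ 3)⁻¹ * (x i).1 p ^ 2 with hH
    have c1 : ∀ w : μ × ν, G2 (fun i => (EuclideanSpace.single w.1 (z i w.2), 0)) x
        (fun i => (EuclideanSpace.single w.1 (z i w.2), 0)) =
        β * weightedVar q (fun i => z i w.2 * unitVec δ x i w.1) -
          ∑ i, q i * (z i w.2 ^ 2 * H i w.1) := by
      intro w
      rw [hG2, ← weightedVar_neg]
      simp only [EuclideanSpace.inner_single_right, add_zero, neg_neg, unitVec, hH, ← hq]
      congr 1
      · congr 2
        ext i
        simp
        ring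
      · refine Finset.sum_congr rfl fun i _ => ?_
        simp
        left
        ring
    have c2 : G2 (fun _ => (0, 1)) x (fun _ => (0, 1)) = 0 := by
      rw [hG2]
      simp [← hq, weightedVar_const hq1]
    have c3 : ∀ p : μ, G2 (fun _ => (EuclideanSpace.single p 1, 0)) x
        (fun _ => (EuclideanSpace.single p 1, 0)) =
        β * weightedVar q (fun i => unitVec δ x i p) - ∑ i, q i * H i p := by
      intro p
      rw [hG2, ← weightedVar_neg]
      simp [unitVec, hH, ← hq, EuclideanSpace.inner_single_right]
    have c4 : ∀ r : ν, G2 (fun i => (0, z i r)) x (fun i => (0, z i r)) =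
        β * weightedVar q (fun i => z i r) := by
      intro r
      rw [hG2]
      simp [← hq]
    -- Since `∑ r, z i r ^ 2 = 1`, the curvature of the smoothed norm has the same trace on both
    -- sides and cancels; only the variance terms remain to be compared.
    have c5 : ∑ w : μ × ν, ∑ i, q i * (z i w.2 ^ 2 * H i w.1) = ∑ p, ∑ i, q i * H i p := by
      rw [Finset.sum_comm, Finset.sum_comm (s := (Finset.univ : Finset μ))]
      refine Finset.sum_congr rfl fun i _ => ?_
      rw [← Finset.mul_sum, ← Finset.mul_sum,
        sum_prod_mul_mul (fun p => H i p) fun r => z i r ^ 2, hz, one_mul]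
    have := weightedVar_gordon hq0 hq1 (sum_unitVec_sq_le hδ x) hz
    simp only [Fintype.sum_sum_type, gordonLeft_single_inl, gordonLeft_single_inr,
      gordonRight_single_inl, gordonRight_single_vec, gordonRight_single_num,
      Finset.univ_unique, Finset.sum_singleton, PUnit.default_eq_unit, gordonLeft_single_unit,
      gordonRight_single_unit, map_zero, c1, c2, c3, c4, zero_add,
      Finset.sum_const_zero, add_zero, Finset.sum_sub_distrib, ← Finset.mul_sum, c5]
    nlinarith [mul_le_mul_of_nonneg_left this hβ.le]

end Gordon

/-! ### The mean norm of a Gaussian vector -/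

section ChiMean

variable {μ : Type*} [Fintype μ] {δ : ℝ}

theorem integral_sq_gaussianReal : ∫ t, t ^ 2 ∂gaussianReal 0 1 = 1 := by
  have := integral_id_mul_gaussianReal (u := fun t => t) (u' := fun _ => 1)
    (fun t => hasDerivAt_id t) (.of_linear 1 fun x => by linarith) (.const _)
  simpa [pow_two] using this

theorem integrable_sq_stdGaussianPi (p : μ) :
    Integrable (fun g : μ → ℝ => g p ^ 2) (stdGaussianPi μ) := by
  have h1 : ExpGrowth fun g : μ → ℝ => g p :=
    .clm (ContinuousLinearMap.proj (R := ℝ) (φ := fun _ : μ => ℝ) p)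
  simp only [pow_two]
  exact (h1.mul h1).integrable (by fun_prop)

theorem integral_sq_stdGaussianPi (p : μ) : ∫ g : μ → ℝ, g p ^ 2 ∂stdGaussianPi μ = 1 := by
  rw [integral_eval_stdGaussianPi (u := fun t => t ^ 2) p (by fun_prop), integral_sq_gaussianReal]

/-- Stein's identity applied to `g p * N`, with `N` the smoothed norm, gives `E (g p ^ 2 / N + N)`;
summing over `p` and using `∑ g p ^ 2 ≤ N ^ 2` yields the factor `card μ + 1`. -/
theorem integral_sum_sq_mul_smoothNorm_le (hδ : 0 < δ) :
    Integrable (fun g : μ → ℝ => (∑ p, g p ^ 2) * smoothNorm δ (toEucL μ g)) (stdGaussianPi μ) ∧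
    ∫ g : μ → ℝ, (∑ p, g p ^ 2) * smoothNorm δ (toEucL μ g) ∂stdGaussianPi μ ≤
      (Fintype.card μ + 1) * ∫ g : μ → ℝ, smoothNorm δ (toEucL μ g) ∂stdGaussianPi μ := by
  classical
  have hN := (isC2Exp_smoothNorm (V := EuclideanSpace ℝ μ) hδ).comp_clm (toEucL μ)
  have hNi := hN.integrable (ContinuousLinearMap.id ℝ (μ → ℝ))
  have hcoord : ∀ p, ExpGrowth fun g : μ → ℝ => g p := fun p =>
    .clm (ContinuousLinearMap.proj (R := ℝ) (φ := fun _ : μ => ℝ) p)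
  have hpos : ∀ g : μ → ℝ, 0 < smoothNorm δ (toEucL μ g) := fun g => smoothNorm_pos hδ _
  have hle : ∀ g : μ → ℝ, ∑ p, g p ^ 2 ≤ smoothNorm δ (toEucL μ g) ^ 2 := fun g => by
    rw [smoothNorm_sq, EuclideanSpace.real_norm_sq_eq]
    simp only [toEucL_apply]
    linarith [sq_nonneg δ]
  have hdg : ∀ p, ExpGrowth fun g : μ → ℝ =>
      g p * ((smoothNorm δ (toEucL μ g))⁻¹ * g p) := fun p => by
    refine (((hcoord p).mul (hcoord p)).mul (.const δ⁻¹)).mono fun g => ?_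
    rw [show g p * ((smoothNorm δ (toEucL μ g))⁻¹ * g p) =
      g p * g p * (smoothNorm δ (toEucL μ g))⁻¹ by ring, norm_mul, norm_mul (g p * g p)]
    refine mul_le_mul_of_nonneg_left ?_ (norm_nonneg _)
    rw [Real.norm_of_nonneg (inv_nonneg.2 (hpos g).le), Real.norm_of_nonneg (inv_nonneg.2 hδ.le)]
    exact inv_anti₀ hδ (Real.le_sqrt_of_sq_le (by nlinarith [sq_nonneg ‖toEucL μ g‖]))
  have hNc : Continuous fun g : μ → ℝ => smoothNorm δ (toEucL μ g) := hN.continuous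
  have hdi : ∀ p, Integrable (fun g : μ → ℝ => g p * ((smoothNorm δ (toEucL μ g))⁻¹ * g p))
      (stdGaussianPi μ) := fun p => (hdg p).integrable
    ((continuous_apply p).mul
      ((hNc.inv₀ fun g => (hpos g).ne').mul (continuous_apply p))).aestronglyMeasurable
  have hstein : ∀ p, ∫ g : μ → ℝ, g p * (g p * smoothNorm δ (toEucL μ g)) ∂stdGaussianPi μ =
      ∫ g : μ → ℝ, (g p * ((smoothNorm δ (toEucL μ g))⁻¹ * g p) + smoothNorm δ (toEucL μ g))
        ∂stdGaussianPi μ := by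
    intro p
    have hd : ∀ g : μ → ℝ, HasFDerivAt (fun g : μ → ℝ => g p * smoothNorm δ (toEucL μ g)) _ g :=
      fun g => (ContinuousLinearMap.proj (R := ℝ) (φ := fun _ : μ => ℝ) p).hasFDerivAt.mul
        (hN.deriv g)
    have e : ∀ g : μ → ℝ, (g p • ((smoothNorm δ (toEucL μ g))⁻¹ •
        innerSL ℝ (toEucL μ g)).comp (toEucL μ) + smoothNorm δ (toEucL μ g) •
        ContinuousLinearMap.proj (R := ℝ) (φ := fun _ : μ => ℝ) p) (Pi.single p 1) =
        g p * ((smoothNorm δ (toEucL μ g))⁻¹ * g p) + smoothNorm δ (toEucL μ g) := by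
      intro g
      have : toEucL μ (Pi.single p 1) = EuclideanSpace.single p 1 := rfl
      simp only [add_apply, smul_apply, ContinuousLinearMap.comp_apply, innerSL_apply_apply, this,
        EuclideanSpace.inner_single_right, ContinuousLinearMap.proj_apply, Pi.single_eq_same]
      simp
    have := integral_coord_mul_stdGaussianPi p hd ((hcoord p).mul hN.growth) ?_
    · refine this.trans ?_
      exact integral_congr_ae (.of_forall e)
    · exact ((hdg p).add hN.growth).mono fun g => le_of_eq (congrArg _ (e g))
  have hint : ∀ p, Integrable (fun g : μ → ℝ => g p * (g p * smoothNorm δ (toEucL μ g)))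
      (stdGaussianPi μ) := fun p => ((hcoord p).mul ((hcoord p).mul hN.growth)).integrable
    ((continuous_apply p).mul ((continuous_apply p).mul hNc)).aestronglyMeasurable
  have hsum : (fun g : μ → ℝ => (∑ p, g p ^ 2) * smoothNorm δ (toEucL μ g)) =
      fun g => ∑ p, g p * (g p * smoothNorm δ (toEucL μ g)) := by
    ext g
    rw [Finset.sum_mul]
    exact Finset.sum_congr rfl fun p _ => by ring
  rw [hsum]
  refine ⟨integrable_finsetSum _ fun p _ => hint p, ?_⟩
  rw [integral_finsetSum _ fun p _ => hint p]
  simp only [hstein]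
  have hint' : ∀ p, Integrable (fun g : μ → ℝ => g p * ((smoothNorm δ (toEucL μ g))⁻¹ * g p) +
      smoothNorm δ (toEucL μ g)) (stdGaussianPi μ) := fun p => (hdi p).add hNi
  rw [← integral_finsetSum _ fun p _ => hint' p, ← integral_const_mul]
  refine integral_mono (integrable_finsetSum _ fun p _ => hint' p) (hNi.const_mul _) fun g => ?_
  simp only [Finset.sum_add_distrib, Finset.sum_const, Finset.card_univ, nsmul_eq_mul]
  have : ∑ p, g p * ((smoothNorm δ (toEucL μ g))⁻¹ * g p) ≤ smoothNorm δ (toEucL μ g) := by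
    have e : ∑ p, g p * ((smoothNorm δ (toEucL μ g))⁻¹ * g p) =
        (∑ p, g p ^ 2) * (smoothNorm δ (toEucL μ g))⁻¹ := by
      rw [Finset.sum_mul]
      exact Finset.sum_congr rfl fun p _ => by ring
    rw [e, mul_inv_le_iff₀ (hpos g), ← pow_two]
    exact hle g
  linarith

/-- With `s = ∑ g p ^ 2` and `c² = card μ + 1`, the pointwise bound `s ≤ (c/2) N + s N / (2c)` is
integrated; by the previous lemma each of the two terms contributes at most `(c/2) E N`, while `E s
= card μ`. -/
theorem le_integral_smoothNorm (hδ : 0 < δ) :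
    (Fintype.card μ : ℝ) ≤ Real.sqrt (Fintype.card μ + 1) *
      ∫ g : μ → ℝ, smoothNorm δ (toEucL μ g) ∂stdGaussianPi μ := by
  obtain ⟨hi, hle⟩ := integral_sum_sq_mul_smoothNorm_le (μ := μ) hδ
  have hN := (isC2Exp_smoothNorm (V := EuclideanSpace ℝ μ) hδ).comp_clm (toEucL μ)
  have hNi : Integrable (fun g : μ → ℝ => smoothNorm δ (toEucL μ g)) (stdGaussianPi μ) :=
    hN.integrable (ContinuousLinearMap.id ℝ (μ → ℝ))
  set c := Real.sqrt (Fintype.card μ + 1) with hc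
  have hc0 : 0 < c := Real.sqrt_pos.2 (by positivity)
  have hc2 : c ^ 2 = Fintype.card μ + 1 := Real.sq_sqrt (by positivity)
  have h1 : (Fintype.card μ : ℝ) = ∫ g : μ → ℝ, ∑ p, g p ^ 2 ∂stdGaussianPi μ := by
    rw [integral_finsetSum _ fun p _ => integrable_sq_stdGaussianPi p]
    simp [integral_sq_stdGaussianPi]
  have h2 : ∫ g : μ → ℝ, ∑ p, g p ^ 2 ∂stdGaussianPi μ ≤
      ∫ g : μ → ℝ, (c / 2 * smoothNorm δ (toEucL μ g) +
        (2 * c)⁻¹ * ((∑ p, g p ^ 2) * smoothNorm δ (toEucL μ g))) ∂stdGaussianPi μ := by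
    refine integral_mono (integrable_finsetSum _ fun p _ => integrable_sq_stdGaussianPi p)
      ((hNi.const_mul _).add (hi.const_mul _)) fun g => ?_
    have hpos := smoothNorm_pos hδ (toEucL μ g)
    have hle : ∑ p, g p ^ 2 ≤ smoothNorm δ (toEucL μ g) ^ 2 := by
      rw [smoothNorm_sq, EuclideanSpace.real_norm_sq_eq]
      simp only [toEucL_apply]
      linarith [sq_nonneg δ]
    have hs : 0 ≤ ∑ p, g p ^ 2 := Finset.sum_nonneg fun p _ => sq_nonneg _
    simp only
    set N := smoothNorm δ (toEucL μ g)
    set s := ∑ p, g p ^ 2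
    -- This is `s (c - N)² ≥ 0` combined with `s ≤ N²`.
    have key : 2 * c * N * s ≤ c ^ 2 * N ^ 2 + s * N ^ 2 := by
      nlinarith [mul_nonneg hs (sq_nonneg (c - N)), mul_nonneg (sq_nonneg c) (sub_nonneg.2 hle)]
    have : c / 2 * N + (2 * c)⁻¹ * (s * N) = (c ^ 2 * N ^ 2 + s * N ^ 2) / (2 * c * N) := by
      field_simp
    rw [this, le_div_iff₀ (by positivity)]
    linarith
  rw [← h1, integral_add (hNi.const_mul _) (hi.const_mul _), integral_const_mul,
    integral_const_mul] at h2
  refine h2.trans ?_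
  rw [← hc2] at hle
  have := mul_le_mul_of_nonneg_left hle (by positivity : 0 ≤ (2 * c)⁻¹)
  have e : (2 * c)⁻¹ * (c ^ 2 * ∫ g : μ → ℝ, smoothNorm δ (toEucL μ g) ∂stdGaussianPi μ) =
      c / 2 * ∫ g : μ → ℝ, smoothNorm δ (toEucL μ g) ∂stdGaussianPi μ := by
    field_simp
  linarith

end ChiMean

/-! ### Escape through a mesh for finite families -/

section Finite

variable {ι μ ν : Type*} [Fintype μ] [Fintype ν] {β δ : ℝ}

theorem matFamily_single [DecidableEq μ] [DecidableEq ν] (z : ι → ν → ℝ) (w : μ × ν) :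
    matFamily μ z (Pi.single w 1) = fun i => (EuclideanSpace.single w.1 (z i w.2), 0) := by
  rw [← gordonLeft_single_inl]
  ext i p
  · simp [matFamily_apply, gordonLeft_apply, Pi.single_apply]
  · simp [matFamily_apply, gordonLeft_apply]

variable [Fintype ι]

/-- The gradient of the smoothed minimum is, up to sign, a convex combination of rank-one matrices
`n_i ⊗ z_i` of Frobenius norm at most 1, so it has norm at most 1 as concentration requires. -/
theorem sum_sq_sum_weight_le {q : ι → ℝ} (hq0 : ∀ i, 0 ≤ q i) (hq1 : ∑ i, q i = 1)
    {n : ι → μ → ℝ} {z : ι → ν → ℝ} (hn : ∀ i, ∑ p, n i p ^ 2 ≤ 1) (hz : ∀ i, ∑ r, z i r ^ 2 = 1) :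
    ∑ w : μ × ν, (∑ i, q i * (z i w.2 * n i w.1)) ^ 2 ≤ 1 := by
  calc ∑ w : μ × ν, (∑ i, q i * (z i w.2 * n i w.1)) ^ 2
      ≤ ∑ w : μ × ν, ∑ i, q i * (z i w.2 ^ 2 * n i w.1 ^ 2) := by
        refine Finset.sum_le_sum fun w _ => ?_
        have := Finset.sum_sq_le_sum_mul_sum_of_sq_le_mul Finset.univ
          (r := fun i => q i * (z i w.2 * n i w.1)) (f := q)
          (g := fun i => q i * (z i w.2 ^ 2 * n i w.1 ^ 2)) (fun i _ => hq0 i)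
          (fun i _ => mul_nonneg (hq0 i) (by positivity)) fun i _ => le_of_eq (by ring)
        rwa [hq1, one_mul] at this
    _ = ∑ i, q i * ∑ p, n i p ^ 2 := by
        rw [Finset.sum_comm]
        refine Finset.sum_congr rfl fun i _ => ?_
        rw [← Finset.mul_sum, sum_prod_mul_mul (fun p => n i p ^ 2) fun r => z i r ^ 2, hz, one_mul]
    _ ≤ ∑ i, q i * 1 := Finset.sum_le_sum fun i _ => mul_le_mul_of_nonneg_left (hn i) (hq0 i)
    _ = 1 := by simpa using hq1

variable [Nonempty ι]

/-- Concentration of the smoothed minimum of `‖M z_i‖`. -/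
theorem measureReal_gordonFun_le (hβ : 0 < β) (hδ : 0 < δ) {z : ι → ν → ℝ}
    (hz : ∀ i, ∑ r, z i r ^ 2 = 1) {r : ℝ} (hr : 0 ≤ r) :
    (stdGaussianPi (μ × ν)).real {g | ∫ g, gordonFun β δ (matFamily μ z g) ∂stdGaussianPi (μ × ν) + r
      ≤ gordonFun β δ (matFamily μ z g)} ≤ Real.exp (-(r ^ 2 / 2)) := by
  classical
  obtain ⟨G', G2, hG, hG1, -⟩ := exists_isC2Exp_gordonFun (ι := ι) (μ := μ) hβ hδ
  refine measureReal_add_le_le_exp (hG.comp_clm (matFamily μ z))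
    (∑ i : ι, (‖(vecL μ i).comp (matFamily μ z)‖ + δ) + β⁻¹ * Real.log (Fintype.card ι))
    (fun g => ?_) (fun g => ?_) hr
  · refine (abs_lse_le hβ _).trans ?_
    rw [add_mul]
    refine add_le_add ?_ ?_
    · rw [Finset.sum_mul]
      refine Finset.sum_le_sum fun i _ => ?_
      have h1 : (matFamily μ z g i).2 = 0 := by rw [matFamily_apply]
      rw [h1, add_zero, abs_neg, abs_of_pos (smoothNorm_pos hδ _)]
      refine (smoothNorm_le hδ.le _).trans ?_
      have h2 := ((vecL μ i).comp (matFamily μ z)).le_opNorm g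
      have h3 : ((vecL μ i).comp (matFamily μ z)) g = (matFamily μ z g i).1 := rfl
      rw [h3] at h2
      nlinarith [norm_nonneg g, norm_nonneg ((vecL μ i).comp (matFamily μ z)), mul_nonneg hδ.le (norm_nonneg g)]
    · have h0 : 0 ≤ β⁻¹ * Real.log (Fintype.card ι) :=
        mul_nonneg (inv_nonneg.2 hβ.le) (Real.log_natCast_nonneg _)
      nlinarith [norm_nonneg g, mul_nonneg h0 (norm_nonneg g)]
  · set x := matFamily μ z g
    have := sum_sq_sum_weight_le (q := gordonWeight β δ x) (fun i => lseWeight_nonneg _ _ _)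
      (sum_lseWeight _ _) (sum_unitVec_sq_le hδ x) hz
    refine le_trans (le_of_eq ?_) this
    refine Finset.sum_congr rfl fun w _ => ?_
    rw [ContinuousLinearMap.comp_apply, matFamily_single, hG1, ← neg_sq, ← Finset.sum_neg_distrib]
    congr 1
    refine Finset.sum_congr rfl fun i _ => ?_
    simp only [EuclideanSpace.inner_single_right, unitVec]
    simp
    left
    ring

/-- After Gordon's comparison every entry is at most `-N(h) + W(g)`, with `N` the smoothed norm;
log-sum-exp adds at most `β⁻¹ log (card ι)`, and `le_integral_smoothNorm` bounds the mean of `N(h)`.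
-/
theorem integral_gordonFun_matFamily_le (hβ : 0 < β) (hδ : 0 < δ) {z : ι → ν → ℝ}
    (hz : ∀ i, ∑ r, z i r ^ 2 = 1) {W : (ν → ℝ) → ℝ} (hW : Integrable W (stdGaussianPi ν))
    (hWz : ∀ i g, ∑ r, g r * z i r ≤ W g) :
    ∫ g, gordonFun β δ (matFamily μ z g) ∂stdGaussianPi (μ × ν) ≤
      -(Fintype.card μ / Real.sqrt (Fintype.card μ + 1)) + ∫ g, W g ∂stdGaussianPi ν +
        β⁻¹ * Real.log (Fintype.card ι) := by
  classical
  obtain ⟨G', G2, hG, -, -⟩ := exists_isC2Exp_gordonFun (ι := ι) (μ := μ) hβ hδ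
  have hN := (isC2Exp_smoothNorm (V := EuclideanSpace ℝ μ) hδ).comp_clm (toEucL μ)
  set e1 : μ → (μ × ν) ⊕ (Unit ⊕ (μ ⊕ ν)) := fun p => Sum.inr (Sum.inr (Sum.inl p))
  set e2 : ν → (μ × ν) ⊕ (Unit ⊕ (μ ⊕ ν)) := fun p => Sum.inr (Sum.inr (Sum.inr p))
  have he1 : e1.Injective := fun a b h => by simpa [e1] using h
  have he2 : e2.Injective := fun a b h => by simpa [e2] using h
  have i1 : Integrable (fun g : (μ × ν) ⊕ (Unit ⊕ (μ ⊕ ν)) → ℝ => smoothNorm δ (toEucL μ (reindexL e1 g)))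
      (stdGaussianPi ((μ × ν) ⊕ (Unit ⊕ (μ ⊕ ν)))) := hN.integrable (reindexL e1)
  have i2 : Integrable (fun g : (μ × ν) ⊕ (Unit ⊕ (μ ⊕ ν)) → ℝ => W (reindexL e2 g)) (stdGaussianPi ((μ × ν) ⊕ (Unit ⊕ (μ ⊕ ν)))) :=
    (measurePreserving_reindexL he2).integrable_comp_of_integrable hW
  have h1 : ∫ g, gordonFun β δ (gordonRight μ z g) ∂stdGaussianPi ((μ × ν) ⊕ (Unit ⊕ (μ ⊕ ν))) ≤
      ∫ g : (μ × ν) ⊕ (Unit ⊕ (μ ⊕ ν)) → ℝ, (-smoothNorm δ (toEucL μ (reindexL e1 g)) + W (reindexL e2 g) +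
        β⁻¹ * Real.log (Fintype.card ι)) ∂stdGaussianPi ((μ × ν) ⊕ (Unit ⊕ (μ ⊕ ν))) := by
    refine integral_mono (hG.integrable _) ((i1.neg.add i2).add (integrable_const _)) fun g => ?_
    refine lse_le hβ fun i => ?_
    rw [gordonRight_apply]
    exact add_le_add_right (hWz i (reindexL e2 g)) _
  have i3 : Integrable (fun g : (μ × ν) ⊕ (Unit ⊕ (μ ⊕ ν)) → ℝ => -smoothNorm δ (toEucL μ (reindexL e1 g)) +
      W (reindexL e2 g)) (stdGaussianPi ((μ × ν) ⊕ (Unit ⊕ (μ ⊕ ν)))) := i1.neg.add i2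
  rw [integral_add i3 (integrable_const _), integral_add (f := fun g => -smoothNorm δ _) i1.neg i2,
    integral_neg,
    integral_reindexL he1 (u := fun g => smoothNorm δ (toEucL μ g))
      hN.continuous.aestronglyMeasurable, integral_reindexL he2 hW.1] at h1
  have h2 := le_integral_smoothNorm (μ := μ) hδ
  have h3 : (0 : ℝ) < Real.sqrt (Fintype.card μ + 1) := Real.sqrt_pos.2 (by positivity)
  have h4 := (div_le_iff₀' h3).2 h2
  have h5 := integral_gordonFun_le (μ := μ) hβ hδ hz
  simp only [integral_const, probReal_univ, one_smul] at h1
  linarith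

/-- Gordon's escape through a mesh for a finite family of unit vectors. -/
theorem measureReal_exists_norm_lt_le {z : ι → ν → ℝ} (hz : ∀ i, ∑ r, z i r ^ 2 = 1)
    {W : (ν → ℝ) → ℝ} (hW : Integrable W (stdGaussianPi ν)) (hWz : ∀ i g, ∑ r, g r * z i r ≤ W g)
    {r τ : ℝ} (hr : 0 < r) (hm : ∫ g, W g ∂stdGaussianPi ν + r + τ ≤
      Fintype.card μ / Real.sqrt (Fintype.card μ + 1)) :
    (stdGaussianPi (μ × ν)).real {g | ∃ i, ‖(matFamily μ z g i).1‖ < τ} ≤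
      Real.exp (-(r ^ 2 / 2)) := by
  -- Smoothing costs an arbitrarily small part `η` of the deviation `r`; it is split evenly between
  -- `δ` and the log-sum-exp error, and removed by letting `η → 0`.
  have hlim : Filter.Tendsto (fun η : ℝ => Real.exp (-((r - η) ^ 2 / 2)))
      (nhdsWithin 0 (Set.Ioi 0)) (nhds (Real.exp (-(r ^ 2 / 2)))) := by
    have : Continuous fun η : ℝ => Real.exp (-((r - η) ^ 2 / 2)) := by fun_prop
    have h := this.tendsto 0
    rw [sub_zero] at h
    exact h.mono_left nhdsWithin_le_nhds
  refine ge_of_tendsto hlim ?_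
  filter_upwards [Ioo_mem_nhdsGT hr] with η hη
  have hη0 : 0 < η := hη.1
  set k := Real.log (Fintype.card ι) with hk
  have hk0 : 0 ≤ k := Real.log_natCast_nonneg _
  set δ := η / 2 with hδd
  have hδ : 0 < δ := by positivity
  -- The `+ 1` keeps `β` positive when the family has a single member and `k = 0`.
  set β := 2 * (k + 1) / η with hβd
  have hβ : 0 < β := by positivity
  have hs : β⁻¹ * k ≤ η / 2 := by
    rw [hβd, inv_div, div_mul_eq_mul_div, div_le_div_iff₀ (by positivity) (by positivity)]
    nlinarith
  have h1 := integral_gordonFun_matFamily_le (μ := μ) hβ hδ hz hW hWz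
  refine le_trans (measureReal_mono ?_) (measureReal_gordonFun_le (μ := μ) hβ hδ hz
    (sub_nonneg.2 hη.2.le))
  rintro g ⟨i, hi⟩
  have h2 : -smoothNorm δ (matFamily μ z g i).1 + (matFamily μ z g i).2 ≤
    gordonFun β δ (matFamily μ z g) := le_lse hβ (fun i => -smoothNorm δ (matFamily μ z g i).1 +
      (matFamily μ z g i).2) i
  have h3 := smoothNorm_le hδ.le (matFamily μ z g i).1
  have h4 : (matFamily μ z g i).2 = 0 := by rw [matFamily_apply]
  simp only [Set.mem_ofPred_eq]
  linarith

end Finite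

/-! ### Mean absolute difference of two standard normals -/

section AbsMoment

theorem integral_abs_gaussianReal_two : ∫ t, |t| ∂gaussianReal 0 2 = 2 / Real.sqrt Real.pi := by
  rw [integral_gaussianReal_eq_integral_smul two_ne_zero]
  have h1 : ∀ t : ℝ, gaussianPDFReal 0 2 t • |t| =
      (fun r : ℝ => (2 * Real.sqrt Real.pi)⁻¹ * (r ^ (1 : ℝ) * Real.exp (-(1 / 4) * r ^ (2 : ℝ)))) |t| := by
    intro t
    have h2 : Real.sqrt (2 * Real.pi * (2 : NNReal)) = 2 * Real.sqrt Real.pi := by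
      rw [show 2 * Real.pi * ((2 : NNReal) : ℝ) = 2 ^ 2 * Real.pi by push_cast; ring,
        Real.sqrt_mul (by positivity), Real.sqrt_sq (by positivity)]
    simp only [gaussianPDFReal, h2, smul_eq_mul, Real.rpow_one, Real.rpow_two, sq_abs]
    rw [show -(t - 0) ^ 2 / (2 * ((2 : NNReal) : ℝ)) = -(1 / 4) * t ^ 2 by push_cast; ring]
    ring
  simp only [h1]
  rw [integral_comp_abs (f := fun r : ℝ =>
    (2 * Real.sqrt Real.pi)⁻¹ * (r ^ (1 : ℝ) * Real.exp (-(1 / 4) * r ^ (2 : ℝ)))),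
    integral_const_mul, integral_rpow_mul_exp_neg_mul_rpow (by norm_num) (by norm_num) (by norm_num)]
  norm_num
  ring

theorem integral_abs_sub_stdGaussianPi {κ : Type*} [Fintype κ] {a b : κ} (hab : a ≠ b) :
    ∫ g : κ → ℝ, |g a - g b| ∂stdGaussianPi κ = 2 / Real.sqrt Real.pi := by
  have h1 : iIndepFun (fun (k : κ) (g : κ → ℝ) => g k) (stdGaussianPi κ) :=
    iIndepFun_pi (X := fun _ => id) fun _ => aemeasurable_id
  have h2 : IndepFun (fun g : κ → ℝ => g a) (fun g : κ → ℝ => -g b) (stdGaussianPi κ) :=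
    (h1.indepFun hab).comp measurable_id measurable_neg
  have h3 : (stdGaussianPi κ).map (fun g : κ → ℝ => -g b) = gaussianReal 0 1 := by
    have := gaussianReal_map_neg (μ := 0) (v := 1)
    rw [neg_zero] at this
    nth_rewrite 1 [← (measurePreserving_eval_stdGaussianPi b).map_eq] at this
    rwa [Measure.map_map (by fun_prop) (by fun_prop)] at this
  have h4 := gaussianReal_add_gaussianReal_of_indepFun h2
    (measurePreserving_eval_stdGaussianPi a).map_eq h3
  rw [add_zero, one_add_one_eq_two] at h4
  have h5 := integral_map (μ := stdGaussianPi κ) (φ := (fun g : κ → ℝ => g a) + fun g => -g b)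
    (f := fun t : ℝ => |t|) (by fun_prop) (by fun_prop)
  rw [h4, integral_abs_gaussianReal_two] at h5
  rw [h5]
  simp [sub_eq_add_neg]

end AbsMoment

/-! ### Escape through a mesh for arbitrary sets of unit vectors -/

section Escape

variable {μ ν : Type*} [Fintype μ] [Fintype ν]

/-- Gordon's escape through a mesh. -/
theorem exists_measurableSet_le_norm {K : Set (ν → ℝ)} (hK : ∀ z ∈ K, ∑ r, z r ^ 2 = 1)
    {W : (ν → ℝ) → ℝ} (hW : Integrable W (stdGaussianPi ν))
    (hWz : ∀ z ∈ K, ∀ g, ∑ r, g r * z r ≤ W g) {r τ : ℝ} (hr : 0 < r)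
    (hm : ∫ g, W g ∂stdGaussianPi ν + r + τ ≤ Fintype.card μ / Real.sqrt (Fintype.card μ + 1)) :
    ∃ B : Set (μ × ν → ℝ), MeasurableSet B ∧
      ENNReal.ofReal (1 - Real.exp (-(r ^ 2 / 2))) ≤ stdGaussianPi (μ × ν) B ∧
      ∀ g ∈ B, ∀ z ∈ K, τ ≤ ‖(WithLp.toLp 2 fun p => ∑ r, g (p, r) * z r : EuclideanSpace ℝ μ)‖ := by
  have hcont (z : ν → ℝ) : Continuous fun g : μ × ν → ℝ =>
      ‖(WithLp.toLp 2 fun p => ∑ r, g (p, r) * z r : EuclideanSpace ℝ μ)‖ := by fun_prop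
  have hcont' (g : μ × ν → ℝ) : Continuous fun z : ν → ℝ =>
      ‖(WithLp.toLp 2 fun p => ∑ r, g (p, r) * z r : EuclideanSpace ℝ μ)‖ := by fun_prop
  obtain ⟨D, hDK, hDc, hDd⟩ :=
    (TopologicalSpace.IsSeparable.of_separableSpace K).exists_countable_dense_subset
  rcases D.eq_empty_or_nonempty with hD | hD
  · refine ⟨Set.univ, MeasurableSet.univ, ?_, fun g _ z hz => ?_⟩
    · rw [measure_univ, ← ENNReal.ofReal_one]
      exact ENNReal.ofReal_le_ofReal (by linarith [Real.exp_pos (-(r ^ 2 / 2))])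
    · have := hDd hz
      simp [hD] at this
  · obtain ⟨u, rfl⟩ := hDc.exists_eq_range hD
    have huK : ∀ n, u n ∈ K := fun n => hDK ⟨n, rfl⟩
    set A : ℕ → Set (μ × ν → ℝ) := fun n =>
      {g | ‖(WithLp.toLp 2 fun p => ∑ r, g (p, r) * u n r : EuclideanSpace ℝ μ)‖ < τ} with hA
    have hAo : ∀ n, MeasurableSet (A n) := fun n =>
      (isOpen_lt (hcont (u n)) continuous_const).measurableSet
    -- The bound for finite families does not depend on their size, so it passes to the increasing
    -- union.
    have hacc : ∀ n, stdGaussianPi (μ × ν) (Set.accumulate A n) ≤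
        ENNReal.ofReal (Real.exp (-(r ^ 2 / 2))) := by
      intro n
      have h1 := measureReal_exists_norm_lt_le (μ := μ) (ι := Fin (n + 1)) (z := fun i => u i)
        (fun i => hK _ (huK i)) hW (fun i => hWz _ (huK i)) hr hm
      rw [← ENNReal.ofReal_toReal (measure_ne_top (stdGaussianPi (μ × ν)) (Set.accumulate A n))]
      refine ENNReal.ofReal_le_ofReal (le_trans (measureReal_mono ?_) h1)
      intro g hg
      obtain ⟨i, hi, hgi⟩ := Set.mem_accumulate.1 hg
      refine ⟨⟨i, by omega⟩, ?_⟩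
      rw [matFamily_apply]
      exact hgi
    have hU : stdGaussianPi (μ × ν) (⋃ n, A n) ≤ ENNReal.ofReal (Real.exp (-(r ^ 2 / 2))) :=
      le_of_tendsto' tendsto_measure_iUnion_accumulate hacc
    have hUm : MeasurableSet (⋃ n, A n) := .iUnion hAo
    refine ⟨(⋃ n, A n)ᶜ, hUm.compl, ?_, fun g hg z hz => ?_⟩
    · rw [prob_compl_eq_one_sub hUm, ENNReal.ofReal_sub _ (Real.exp_pos _).le, ENNReal.ofReal_one]
      exact tsub_le_tsub_left hU 1
    -- For fixed `g` the lower bound is a closed condition on `z`, hence extends from the dense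
    -- sequence to all of `K`.
    · have hcl : IsClosed {z : ν → ℝ |
          τ ≤ ‖(WithLp.toLp 2 fun p => ∑ r, g (p, r) * z r : EuclideanSpace ℝ μ)‖} :=
        isClosed_le continuous_const (hcont' g)
      refine hcl.closure_subset_iff.2 ?_ (hDd hz)
      rintro _ ⟨n, rfl⟩
      by_contra h
      exact hg (Set.mem_iUnion.2 ⟨n, by simpa [hA] using h⟩)

end Escape

/-! ### Descent directions of the analysis seminorm -/

section Descent

variable {ι κ : Type*} [Fintype ι] [Fintype κ] (Ω : Matrix ι κ ℝ)

/-- The directional derivative of `z ↦ ‖Ω z‖₁` at `x` in the direction `h`. -/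
def dirDeriv (x h : κ → ℝ) : ℝ :=
  ∑ i, if (Ω *ᵥ x) i = 0 then |(Ω *ᵥ h) i| else Real.sign ((Ω *ᵥ x) i) * (Ω *ᵥ h) i

/-- The subgradient inequality, coordinate by coordinate. It makes `xhat - x` a direction of
non-positive derivative whenever `xhat` does not increase the seminorm. -/
theorem dirDeriv_le (x h : EuclideanSpace ℝ κ) :
    dirDeriv Ω x.ofLp h.ofLp ≤ analysisL1 Ω (x + h) - analysisL1 Ω x := by
  unfold dirDeriv analysisL1
  rw [← Finset.sum_sub_distrib]
  refine Finset.sum_le_sum fun i _ => ?_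
  rw [WithLp.ofLp_add, Matrix.mulVec_add, Pi.add_apply]
  split_ifs with h0
  · simp [h0]
  · rcases lt_or_gt_of_ne h0 with h1 | h1
    · rw [Real.sign_of_neg h1, abs_of_neg h1]
      linarith [neg_abs_le ((Ω *ᵥ x.ofLp) i + (Ω *ᵥ h.ofLp) i)]
    · rw [Real.sign_of_pos h1, abs_of_pos h1]
      linarith [le_abs_self ((Ω *ᵥ x.ofLp) i + (Ω *ᵥ h.ofLp) i)]

theorem dirDeriv_smul (x h : κ → ℝ) {c : ℝ} (hc : 0 ≤ c) :
    dirDeriv Ω x (c • h) = c * dirDeriv Ω x h := by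
  unfold dirDeriv
  rw [Finset.mul_sum]
  refine Finset.sum_congr rfl fun i _ => ?_
  rw [Matrix.mulVec_smul, Pi.smul_apply, smul_eq_mul]
  split_ifs
  · rw [abs_mul, abs_of_nonneg hc]
  · ring

/-- A subgradient `b` at `x` has `⟨b, z⟩ ≤ dirDeriv Ω x z ≤ 0`, so `⟨g, z⟩ ≤ ⟨g - t b, z⟩ ≤ ‖g - t
b‖² / (2ρ) + ρ / 2`. The quadratic bound replaces the norm, so that only the mean of a square has to
be computed. -/
theorem sum_mul_le_of_dirDeriv_nonpos {C : ℝ} (hΩ : ∀ k, ∑ i, |Ω i k| ≤ C) {x z : κ → ℝ}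
    (hz : ∑ k, z k ^ 2 = 1) (hxz : dirDeriv Ω x z ≤ 0) {t ρ : ℝ} (ht : 0 ≤ t) (hρ : 0 < ρ)
    (g : κ → ℝ) :
    ∑ k, g k * z k ≤
      (∑ k, g k ^ 2 - 2 * t * dirDeriv Ω x g + Fintype.card κ * (C * t) ^ 2) / (2 * ρ) + ρ / 2 := by
  -- On the cosupport the signs are free; copying those of `Ω g` selects the subgradient `v ᵥ* Ω`
  -- with the largest inner product with `g`, namely `dirDeriv Ω x g`.
  set v : ι → ℝ := fun i =>
    if (Ω *ᵥ x) i = 0 then Real.sign ((Ω *ᵥ g) i) else Real.sign ((Ω *ᵥ x) i) with hv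
  have hsign : ∀ a : ℝ, |Real.sign a| ≤ 1 := fun a => by
    rcases Real.sign_apply_eq a with h | h | h <;> rw [h] <;> norm_num
  have hv1 : ∀ i, |v i| ≤ 1 := fun i => by
    simp only [hv]
    split_ifs <;> exact hsign _
  have hvg : v ⬝ᵥ (Ω *ᵥ g) = dirDeriv Ω x g := by
    refine Finset.sum_congr rfl fun i _ => ?_
    simp only [hv]
    split_ifs
    · rcases lt_trichotomy ((Ω *ᵥ g) i) 0 with h | h | h
      · rw [Real.sign_of_neg h, abs_of_neg h]; ring
      · rw [h]; simp
      · rw [Real.sign_of_pos h, abs_of_pos h]; ring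
    · rfl
  have hvz : v ⬝ᵥ (Ω *ᵥ z) ≤ 0 := by
    refine le_trans (Finset.sum_le_sum fun i _ => ?_) hxz
    by_cases h : (Ω *ᵥ x) i = 0
    · rw [if_pos h]
      calc v i * (Ω *ᵥ z) i ≤ |v i| * |(Ω *ᵥ z) i| := by rw [← abs_mul]; exact le_abs_self _
        _ ≤ |(Ω *ᵥ z) i| := mul_le_of_le_one_left (abs_nonneg _) (hv1 i)
    · simp only [hv, if_neg h, le_refl]
  set b : κ → ℝ := v ᵥ* Ω with hb
  rw [Matrix.dotProduct_mulVec, ← hb] at hvg hvz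
  have hbC : ∀ k, b k ^ 2 ≤ C ^ 2 := fun k => by
    refine sq_le_sq' ?_ ?_ <;> [rw [neg_le]; skip] <;> refine le_trans ?_ (hΩ k)
    · change -∑ i, v i * Ω i k ≤ _
      rw [← Finset.sum_neg_distrib]
      refine Finset.sum_le_sum fun i _ => ?_
      calc -(v i * Ω i k) ≤ |v i| * |Ω i k| := by rw [← abs_mul]; exact neg_le_abs _
        _ ≤ |Ω i k| := mul_le_of_le_one_left (abs_nonneg _) (hv1 i)
    · change ∑ i, v i * Ω i k ≤ _
      refine Finset.sum_le_sum fun i _ => ?_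
      calc v i * Ω i k ≤ |v i| * |Ω i k| := by rw [← abs_mul]; exact le_abs_self _
        _ ≤ |Ω i k| := mul_le_of_le_one_left (abs_nonneg _) (hv1 i)
  have h1 : 0 ≤ ∑ k, (g k - t * b k - ρ * z k) ^ 2 := Finset.sum_nonneg fun k _ => sq_nonneg _
  have h2 : ∑ k, (g k - t * b k - ρ * z k) ^ 2 = ∑ k, g k ^ 2 - 2 * t * (b ⬝ᵥ g) +
      t ^ 2 * ∑ k, b k ^ 2 - 2 * ρ * ∑ k, g k * z k + 2 * ρ * t * (b ⬝ᵥ z) + ρ ^ 2 * ∑ k, z k ^ 2 := by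
    simp only [dotProduct, Finset.mul_sum, ← Finset.sum_sub_distrib, ← Finset.sum_add_distrib]
    exact Finset.sum_congr rfl fun k _ => by ring
  have h3 : ∑ k, b k ^ 2 ≤ Fintype.card κ * C ^ 2 := by
    calc _ ≤ ∑ _k : κ, C ^ 2 := Finset.sum_le_sum fun k _ => hbC k
      _ = _ := by simp
  have h4 : ρ * t * (b ⬝ᵥ z) ≤ 0 := mul_nonpos_of_nonneg_of_nonpos (by positivity) hvz
  have h5 := mul_le_mul_of_nonneg_left h3 (sq_nonneg t)
  rw [h2, hz, hvg] at h1
  rw [div_add_div _ _ (by positivity) (by norm_num), le_div_iff₀ (by positivity)]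
  nlinarith

end Descent

/-! ### The two-dimensional difference operator -/

section DiffOp

variable {d : ℕ}

theorem hi_injective : (hi : Fin (d - 1) → Fin d).Injective := fun a b h => by
  simpa [hi, Fin.ext_iff] using h

theorem lo_injective : (lo : Fin (d - 1) → Fin d).Injective := fun a b h => by
  simpa [lo, Fin.ext_iff] using h

theorem hi_ne_lo (i : Fin (d - 1)) : (hi i : Fin d) ≠ lo i := by
  simp [hi, lo, Fin.ext_iff]

theorem exists_diffOp_mulVec (r : DiffIndex d) : ∃ a b : Fin d × Fin d, a ≠ b ∧
    ∀ x : Fin d × Fin d → ℝ, (diffOp d *ᵥ x) r = x a - x b := by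
  rcases r with ⟨i, j⟩ | ⟨i, j⟩
  · exact ⟨_, _, by simp [hi_ne_lo], fun x => diffOp_mulVec_inl x i j⟩
  · exact ⟨_, _, by simp [hi_ne_lo], fun x => diffOp_mulVec_inr x i j⟩

theorem sum_single_le_one {α β : Type*} [Fintype α] [DecidableEq β] {f : α → β} (hf : f.Injective)
    (k : β) : ∑ a, (Pi.single (f a) 1 : β → ℝ) k ≤ 1 := by
  classical
  simp only [Pi.single_apply]
  rw [Finset.sum_boole]
  have : (Finset.univ.filter fun a => k = f a).card ≤ 1 := by
    refine Finset.card_le_one.2 fun a ha b hb => hf ?_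
    rw [← (Finset.mem_filter.1 ha).2, ← (Finset.mem_filter.1 hb).2]
  exact_mod_cast this

/-- A pixel occurs in at most one difference towards each of its four neighbours. -/
theorem sum_abs_diffOp_le (k : Fin d × Fin d) : ∑ r, |diffOp d r k| ≤ 4 := by
  have h0 : ∀ (p q : Fin d × Fin d), |(Pi.single p 1 - Pi.single q 1 : Fin d × Fin d → ℝ) k| ≤
      (Pi.single p 1 : Fin d × Fin d → ℝ) k + (Pi.single q 1 : Fin d × Fin d → ℝ) k := by
    intro p q
    have h1 : ∀ p, 0 ≤ (Pi.single p 1 : Fin d × Fin d → ℝ) k := fun p => by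
      rw [Pi.single_apply]; split_ifs <;> norm_num
    rw [Pi.sub_apply, abs_le]
    constructor <;> linarith [h1 p, h1 q]
  have e1 : ∑ r : Fin (d - 1) × Fin d, |diffOp d (Sum.inl r) k| ≤ 2 := by
    calc _ ≤ ∑ r : Fin (d - 1) × Fin d, ((Pi.single (hi r.1, r.2) 1 : Fin d × Fin d → ℝ) k +
          (Pi.single (lo r.1, r.2) 1 : Fin d × Fin d → ℝ) k) :=
          Finset.sum_le_sum fun r _ => h0 _ _
      _ ≤ 2 := by
        rw [Finset.sum_add_distrib]
        linarith [sum_single_le_one (f := fun r : Fin (d - 1) × Fin d => ((hi r.1 : Fin d), r.2))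
            (hi_injective.prodMap Function.injective_id) k,
          sum_single_le_one (f := fun r : Fin (d - 1) × Fin d => ((lo r.1 : Fin d), r.2))
            (lo_injective.prodMap Function.injective_id) k]
  have e2 : ∑ r : Fin d × Fin (d - 1), |diffOp d (Sum.inr r) k| ≤ 2 := by
    calc _ ≤ ∑ r : Fin d × Fin (d - 1), ((Pi.single (r.1, hi r.2) 1 : Fin d × Fin d → ℝ) k +
          (Pi.single (r.1, lo r.2) 1 : Fin d × Fin d → ℝ) k) :=
          Finset.sum_le_sum fun r _ => h0 _ _
      _ ≤ 2 := by
        rw [Finset.sum_add_distrib]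
        linarith [sum_single_le_one (f := fun r : Fin d × Fin (d - 1) => (r.1, (hi r.2 : Fin d)))
            (Function.injective_id.prodMap hi_injective) k,
          sum_single_le_one (f := fun r : Fin d × Fin (d - 1) => (r.1, (lo r.2 : Fin d)))
            (Function.injective_id.prodMap lo_injective) k]
  rw [Fintype.sum_sum_type]
  linarith

/-- Terms off the cosupport are centred, and each of the `ℓ` others is the absolute difference of
two distinct coordinates. Only the size of the cosupport matters, not its geometry. -/
theorem integral_dirDeriv_diffOp {ℓ : ℕ} {x : EuclideanSpace ℝ (Fin d × Fin d)}
    (hx : IsCosparse (diffOp d) ℓ x) :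
    Integrable (dirDeriv (diffOp d) x.ofLp) (stdGaussianPi (Fin d × Fin d)) ∧
    ∫ g, dirDeriv (diffOp d) x.ofLp g ∂stdGaussianPi (Fin d × Fin d) =
      ℓ * (2 / Real.sqrt Real.pi) := by
  have hcoord : ∀ k : Fin d × Fin d, Integrable (fun g : Fin d × Fin d → ℝ => g k)
      (stdGaussianPi (Fin d × Fin d)) := fun k =>
    (ExpGrowth.clm (ContinuousLinearMap.proj (R := ℝ)
      (φ := fun _ : Fin d × Fin d => ℝ) k)).integrable (by fun_prop)
  have hcoord0 : ∀ k : Fin d × Fin d, ∫ g : Fin d × Fin d → ℝ, g k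
      ∂stdGaussianPi (Fin d × Fin d) = 0 := fun k => by
    rw [integral_eval_stdGaussianPi (u := fun t => t) k measurable_id, integral_id_gaussianReal]
  choose a b hab hΩ using exists_diffOp_mulVec (d := d)
  have hterm : ∀ i, Integrable (fun g : Fin d × Fin d → ℝ =>
        if (diffOp d *ᵥ x.ofLp) i = 0 then |(diffOp d *ᵥ g) i|
        else Real.sign ((diffOp d *ᵥ x.ofLp) i) * (diffOp d *ᵥ g) i)
        (stdGaussianPi (Fin d × Fin d)) ∧
      ∫ g : Fin d × Fin d → ℝ, (if (diffOp d *ᵥ x.ofLp) i = 0 then |(diffOp d *ᵥ g) i|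
        else Real.sign ((diffOp d *ᵥ x.ofLp) i) * (diffOp d *ᵥ g) i)
        ∂stdGaussianPi (Fin d × Fin d) =
      if (diffOp d *ᵥ x.ofLp) i = 0 then 2 / Real.sqrt Real.pi else 0 := by
    intro i
    have h1 : Integrable (fun g : Fin d × Fin d → ℝ => (diffOp d *ᵥ g) i)
        (stdGaussianPi (Fin d × Fin d)) := by
      simp only [hΩ i]
      exact (hcoord _).sub (hcoord _)
    split_ifs with h
    · refine ⟨h1.abs, ?_⟩
      simp only [hΩ i]
      exact integral_abs_sub_stdGaussianPi (hab i)
    · refine ⟨h1.const_mul _, ?_⟩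
      rw [integral_const_mul]
      simp only [hΩ i]
      rw [integral_sub (hcoord _) (hcoord _), hcoord0, hcoord0, sub_zero, mul_zero]
  refine ⟨integrable_finsetSum _ fun i _ => (hterm i).1, ?_⟩
  have hcard : (Finset.univ.filter fun i => (diffOp d *ᵥ x.ofLp) i = 0).card = ℓ := by
    have h1 := Finset.card_filter_add_card_filter_not (s := (Finset.univ : Finset (DiffIndex d)))
      (fun i => (diffOp d *ᵥ x.ofLp) i = 0)
    have h2 : (Finset.univ.filter fun i => ¬(diffOp d *ᵥ x.ofLp) i = 0).card + ℓ =
      Fintype.card (DiffIndex d) := hx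
    rw [Finset.card_univ] at h1
    omega
  unfold dirDeriv
  rw [integral_finsetSum _ fun i _ => (hterm i).1]
  simp only [(hterm _).2]
  rw [← Finset.sum_filter, Finset.sum_const, hcard, nsmul_eq_mul]

end DiffOp

/-! ### From a lower bound on the descent cone to robust recovery -/

section Recovery

variable {ι κ μ : Type*} [Fintype ι] [Fintype κ] [Fintype μ]

/-- Robust recovery when `M` is bounded below on the cone of descent directions. -/
theorem IsMinimizer.norm_sub_le {Ω : Matrix ι κ ℝ} {M : Matrix μ κ ℝ} {x xhat : EuclideanSpace ℝ κ}
    {w : EuclideanSpace ℝ μ} {η τ : ℝ} (hτ : 0 < τ) (hw : ‖w‖ ≤ η)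
    (hM : ∀ z : κ → ℝ, ∑ k, z k ^ 2 = 1 → dirDeriv Ω x.ofLp z ≤ 0 →
      τ ≤ ‖applyMat M (WithLp.toLp 2 z)‖)
    (h : IsMinimizer Ω M (applyMat M x + w) η xhat) : ‖x - xhat‖ ≤ 2 * η / τ := by
  have hη : 0 ≤ η := (norm_nonneg w).trans hw
  obtain ⟨hfeas, hmin⟩ := h
  set v : EuclideanSpace ℝ κ := xhat - x with hv
  have hMv : applyMat M xhat = applyMat M x + applyMat M v := by
    simp only [applyMat, hv, WithLp.ofLp_sub, Matrix.mulVec_sub, ← WithLp.toLp_add]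
    congr 1
    abel
  have hMv2 : ‖applyMat M v‖ ≤ 2 * η := by
    have : applyMat M v = (applyMat M xhat - (applyMat M x + w)) + w := by rw [hMv]; abel
    rw [this]
    linarith [norm_add_le (applyMat M xhat - (applyMat M x + w)) w]
  have hL := hmin x (by simpa using hw)
  have hdesc : dirDeriv Ω x.ofLp v.ofLp ≤ 0 := by
    have := dirDeriv_le Ω x v
    rw [show x + v = xhat by rw [hv]; abel] at this
    linarith
  rw [norm_sub_rev, ← hv, le_div_iff₀ hτ]
  rcases eq_or_ne v 0 with h0 | h0
  · rw [h0, norm_zero, zero_mul]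
    positivity
  · have hn : 0 < ‖v‖ := norm_pos_iff.2 h0
    have hz := hM (‖v‖⁻¹ • v.ofLp) ?_ ?_
    · have e : applyMat M (WithLp.toLp 2 (‖v‖⁻¹ • v.ofLp)) = ‖v‖⁻¹ • applyMat M v := by
        simp only [applyMat, Matrix.mulVec_smul, WithLp.toLp_smul]
      rw [e, norm_smul, norm_inv, norm_norm, ← div_eq_inv_mul, le_div_iff₀ hn] at hz
      linarith
    · simp only [Pi.smul_apply, smul_eq_mul, mul_pow, ← Finset.mul_sum]
      rw [← EuclideanSpace.real_norm_sq_eq, inv_pow, inv_mul_cancel₀ (by positivity)]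
    · rw [dirDeriv_smul Ω _ _ (by positivity)]
      exact mul_nonpos_of_nonneg_of_nonpos (by positivity) hdesc

end Recovery

/-! ### The Gaussian width of the descent cone -/

section Width

/-- The bound for the Gaussian width of the cone of descent directions. -/
theorem exists_width_bound {d s ℓ : ℕ} (hd : 0 < d) {x : EuclideanSpace ℝ (Fin d × Fin d)}
    (hx : IsCosparse (diffOp d) ℓ x) (hs : s + ℓ = 2 * d * (d - 1)) :
    ∃ W : (Fin d × Fin d → ℝ) → ℝ, Integrable W (stdGaussianPi (Fin d × Fin d)) ∧
      ∫ g, W g ∂stdGaussianPi (Fin d × Fin d) ≤ Real.sqrt ((d : ℝ) ^ 2 *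
        (1 - 1 / Real.pi * (1 - 1 / (d : ℝ) - (s : ℝ) / (2 * (d : ℝ) ^ 2)) ^ 2)) ∧
      ∀ z : Fin d × Fin d → ℝ, ∑ k, z k ^ 2 = 1 → dirDeriv (diffOp d) x.ofLp z ≤ 0 →
        ∀ g, ∑ k, g k * z k ≤ W g := by
  obtain ⟨hDi, hD⟩ := integral_dirDeriv_diffOp hx
  have hd' : (0 : ℝ) < d := by exact_mod_cast hd
  have hd1 : (1 : ℝ) ≤ d := by exact_mod_cast hd
  have hpi := Real.pi_pos
  have hsq := Real.sqrt_pos.2 hpi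
  have hsq2 : Real.sqrt Real.pi ^ 2 = Real.pi := Real.sq_sqrt hpi.le
  have hs' : (s : ℝ) + ℓ = 2 * d * (d - 1) := by
    have : ((s + ℓ : ℕ) : ℝ) = ((2 * d * (d - 1) : ℕ) : ℝ) := by rw [hs]
    push_cast [Nat.cast_sub hd] at this
    exact this
  set q : ℝ := 1 - 1 / (d : ℝ) - (s : ℝ) / (2 * (d : ℝ) ^ 2) with hq
  -- The quantity squared in the hypothesis is the fraction of vanishing differences relative to
  -- `2d²`, hence lies in `[0, 1]`.
  have hqℓ : q = ℓ / (2 * (d : ℝ) ^ 2) := by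
    rw [hq]
    field_simp
    linarith
  have hq0 : 0 ≤ q := by rw [hqℓ]; positivity
  have hq1 : q ≤ 1 := by
    rw [hqℓ, div_le_one (by positivity)]
    nlinarith [(Nat.cast_nonneg s : (0 : ℝ) ≤ s)]
  set ρ := Real.sqrt ((d : ℝ) ^ 2 * (1 - 1 / Real.pi * q ^ 2)) with hρd
  have hpos : 0 < (d : ℝ) ^ 2 * (1 - 1 / Real.pi * q ^ 2) := by
    have h1 : 1 / Real.pi < 1 := by
      rw [div_lt_one hpi]
      linarith [Real.pi_gt_three]
    have h2 : q ^ 2 ≤ 1 := pow_le_one₀ hq0 hq1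
    have h3 : 1 / Real.pi * q ^ 2 ≤ 1 / Real.pi := mul_le_of_le_one_right (by positivity) h2
    exact mul_pos (by positivity) (by linarith)
  have hρ : 0 < ρ := Real.sqrt_pos.2 hpos
  have hρ2 : ρ ^ 2 = (d : ℝ) ^ 2 * (1 - 1 / Real.pi * q ^ 2) := Real.sq_sqrt hpos.le
  -- The minimizer of `d² - 8 d² q t / √π + 16 d² t²`, whose minimum is `d² (1 - q²/π) = ρ²`; with
  -- this `ρ` the quadratic bound `ρ² / (2ρ) + ρ / 2` is exactly `ρ`.
  set t : ℝ := q / (4 * Real.sqrt Real.pi) with ht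
  have ht0 : 0 ≤ t := by positivity
  have hcard : (Fintype.card (Fin d × Fin d) : ℝ) = (d : ℝ) ^ 2 := by
    simp [pow_two]
  refine ⟨fun g => (∑ k, g k ^ 2 - 2 * t * dirDeriv (diffOp d) x.ofLp g +
    Fintype.card (Fin d × Fin d) * (4 * t) ^ 2) / (2 * ρ) + ρ / 2, ?_, ?_, fun z hz hxz g =>
    sum_mul_le_of_dirDeriv_nonpos (diffOp d) sum_abs_diffOp_le hz hxz ht0 hρ g⟩
  · exact ((((integrable_finsetSum _ fun k _ => integrable_sq_stdGaussianPi k).sub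
      (hDi.const_mul _)).add (integrable_const _)).div_const _).add (integrable_const _)
  · have i1 : Integrable (fun g : Fin d × Fin d → ℝ => ∑ k, g k ^ 2)
        (stdGaussianPi (Fin d × Fin d)) :=
      integrable_finsetSum _ fun k _ => integrable_sq_stdGaussianPi k
    have i2 := i1.sub (hDi.const_mul (2 * t))
    have i3 := i2.add (integrable_const ((Fintype.card (Fin d × Fin d) : ℝ) * (4 * t) ^ 2))
    simp only [Pi.sub_def, Pi.add_def] at i2 i3
    rw [integral_add (i3.div_const _) (integrable_const _), integral_div,
      integral_add i2 (integrable_const _), integral_sub i1 (hDi.const_mul _), integral_const_mul,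
      hD, integral_finsetSum _ fun k _ => integrable_sq_stdGaussianPi k]
    simp only [integral_sq_stdGaussianPi, Finset.sum_const, Finset.card_univ, nsmul_eq_mul, mul_one,
      integral_const, probReal_univ, smul_eq_mul, one_mul, hcard]
    have e1 : (ℓ : ℝ) = 2 * (d : ℝ) ^ 2 * q := by
      rw [hqℓ]
      field_simp
    have e2 : 2 * t * (ℓ * (2 / Real.sqrt Real.pi)) = 2 * ((d : ℝ) ^ 2 * (1 / Real.pi * q ^ 2)) := by
      rw [e1, ht]
      field_simp
      rw [hsq2]
      ring
    have e3 : (4 * t) ^ 2 = 1 / Real.pi * q ^ 2 := by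
      rw [ht]
      field_simp
      rw [hsq2]
    have e4 : (d : ℝ) ^ 2 - 2 * t * (ℓ * (2 / Real.sqrt Real.pi)) + (d : ℝ) ^ 2 * (4 * t) ^ 2 =
        ρ ^ 2 := by
      rw [e2, e3, hρ2]
      ring
    rw [e4]
    refine le_of_eq ?_
    field_simp
    ring

end Width

end AnalysisRecovery

end

/-! ### The recovery theorem -/

theorem mainTheorem3 {S : Type*} [MeasurableSpace S] (P : Measure S) [IsProbabilityMeasure P]
    (d m s ℓ : ℕ) (hd : 0 < d)
    (x : EuclideanSpace ℝ (Fin d × Fin d))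
    (hx : AnalysisRecovery.IsCosparse (AnalysisRecovery.diffOp d) ℓ x)
    (hs : s + ℓ = 2 * d * (d - 1))
    (M : S → Matrix (Fin m) (Fin d × Fin d) ℝ)
    (hM : AnalysisRecovery.IsGaussianMatrix P M)
    (η τ ε : ℝ) (hτ : 0 < τ) (hε0 : 0 < ε) (hε1 : ε < 1)
    (hm : (Real.sqrt ((d : ℝ) ^ 2 *
            (1 - 1 / Real.pi * (1 - 1 / (d : ℝ) - (s : ℝ) / (2 * (d : ℝ) ^ 2)) ^ 2))
          + Real.sqrt (2 * Real.log ε⁻¹) + τ) ^ 2 ≤ (m : ℝ) ^ 2 / ((m : ℝ) + 1)) :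
    ∃ E : Set S, MeasurableSet E ∧ ENNReal.ofReal (1 - ε) ≤ P E ∧
      ∀ ω ∈ E, ∀ w : EuclideanSpace ℝ (Fin m), ‖w‖ ≤ η →
        ∀ xhat : EuclideanSpace ℝ (Fin d × Fin d),
          AnalysisRecovery.IsMinimizer (AnalysisRecovery.diffOp d) (M ω)
            (AnalysisRecovery.applyMat (M ω) x + w) η xhat →
          ‖x - xhat‖ ≤ 2 * η / τ := by
  obtain ⟨W, hW, hWle, hWz⟩ := AnalysisRecovery.exists_width_bound hd hx hs
  have hlog : 0 < 2 * Real.log ε⁻¹ := mul_pos two_pos (Real.log_pos ((one_lt_inv₀ hε0).2 hε1))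
  have hr : 0 < Real.sqrt (2 * Real.log ε⁻¹) := Real.sqrt_pos.2 hlog
  have hm' : ∫ g, W g ∂AnalysisRecovery.stdGaussianPi (Fin d × Fin d) +
      Real.sqrt (2 * Real.log ε⁻¹) + τ ≤
      Fintype.card (Fin m) / Real.sqrt (Fintype.card (Fin m) + 1) := by
    have h1 := Real.le_sqrt_of_sq_le hm
    rw [Real.sqrt_div (by positivity), Real.sqrt_sq (by positivity)] at h1
    rw [Fintype.card_fin]
    linarith
  obtain ⟨B, hB, hBP, hBz⟩ := AnalysisRecovery.exists_measurableSet_le_norm (μ := Fin m)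
    (K := {z | ∑ k, z k ^ 2 = 1 ∧
      AnalysisRecovery.dirDeriv (AnalysisRecovery.diffOp d) x.ofLp z ≤ 0})
    (fun z hz => hz.1) hW (fun z hz => hWz z hz.1 hz.2) hr hm'
  rw [Real.sq_sqrt hlog.le, mul_div_cancel_left₀ _ two_ne_zero, Real.log_inv, neg_neg,
    Real.exp_log hε0] at hBP
  have hlaw := AnalysisRecovery.map_eq_stdGaussianPi
    (X := fun (ij : Fin m × (Fin d × Fin d)) ω => M ω ij.1 ij.2)
    (fun ij => hM.hasLaw ij.1 ij.2) hM.indep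
  have hX : AEMeasurable (fun ω (ij : Fin m × (Fin d × Fin d)) => M ω ij.1 ij.2) P :=
    aemeasurable_pi_lambda _ fun ij => (hM.hasLaw ij.1 ij.2).aemeasurable
  rw [← hlaw, Measure.map_apply_of_aemeasurable hX hB] at hBP
  -- The entries of `M` are only almost everywhere measurable, so the preimage of `B` is merely
  -- null-measurable and is replaced by a measurable subset of equal probability.
  obtain ⟨E, hEB, hE, hEae⟩ := (hX.nullMeasurableSet_preimage hB).exists_measurable_subset_ae_eq
  refine ⟨E, hE, by rwa [measure_congr hEae], fun ω hω w hw xhat hmin => ?_⟩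
  exact hmin.norm_sub_le hτ hw fun z hz hxz => hBz _ (hEB hω) z ⟨hz, hxz⟩
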